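/- Let $Z=(Z_H(t))_{t\in[0,\infty),\,H\in(0,1)}$ be a fractional Gaussian field on a probability space $(\Omega,\mathcal F,\mathbb P)$, that is, a jointly Gaussian, centered family of real random variables with $$\mathbb E[Z_H(t)Z_{H'}(s)]=\frac{a_{H,H'}}{2}\left(|t|^{H+H'}+|s|^{H+H'}-|t-s|^{H+H'}\right),$$ where, for $H+H'\neq 1$, $$a_{H,H'}=-\tfrac{2}{\pi}\sqrt{\Gamma(2H+1)\sin(\pi H)}\,\sqrt{\Gamma(2H'+1)\sin(\pi H')}\,\Gamma(-(H+H'))\cos\!\left((H'-H)\tfrac{\pi}{2}\right)\cos\!\left((H+H')\tfrac{\pi}{2}\right),$$ and, for $H+H'=1$, $a_{H,H'}=a_H:=\sqrt{\Gamma(2H+1)\Gamma(3-2H)}\,\sin^2(\pi H)$. Fix $H\in(0,1)$, let $\mathcal F_t^H=\sigma(Z_H(r):0\le r\le t)$, and let $M_H$ be (any version of) the process $$M_H(t)=\mathbb E\left[Z_{1-H}(t)\,\middle|\,\mathcal F_t^H\right],\qquad t\ge 0 .$$ Put $$c_M=\frac{a_H^2\,\Gamma(3/2-H)}{2H\,\Gamma(H+1/2)\,\Gamma(3-2H)}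 .$$ Then for every $t\ge 0$, with $t_i=\tfrac{it}{n}$, $i=0,\dots,n$, $$\lim_{n\to\infty}\left\|\sum_{i=1}^n\left(M_H(t_i)-M_H(t_{i-1})\right)^2-c_M\,t^{2-2H}\right\|_{2}=0,$$ where $\|X\|_2=\sqrt{\mathbb E[X^2]}$, and $$\lim_{n\to\infty}\sum_{i=1}^n\left(M_H(t_i)-M_H(t_{i-1})\right)^2=c_M\,t^{2-2H}\qquad\text{almost surely.}$$ -/

import Mathlib

open MeasureTheory ProbabilityTheory Filter Topology
open scoped NNReal ENNReal

noncomputable section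

/-- The constant `a_H = √(Γ(2H+1) Γ(3-2H)) sin²(πH)`. -/
def dualConst (H : ℝ) : ℝ :=
  √(Real.Gamma (2 * H + 1) * Real.Gamma (3 - 2 * H)) * Real.sin (Real.pi * H) ^ 2

/-- The constant `a_{H,H'}` in the covariance of the fractional Gaussian field. -/
def fieldConst (H H' : ℝ) : ℝ :=
  if H + H' = 1 then dualConst H
  else
    -(2 / Real.pi) * √(Real.Gamma (2 * H + 1) * Real.sin (Real.pi * H))
      * √(Real.Gamma (2 * H' + 1) * Real.sin (Real.pi * H'))
      * Real.Gamma (-(H + H')) * Real.cos ((H' - H) * (Real.pi / 2))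
      * Real.cos ((H + H') * (Real.pi / 2))

/-- `Z = (Z_H(t))`, with `t ∈ [0,∞)` and `H ∈ (0,1)`, is a fractional Gaussian field on the
probability space `(Ω, P)`: a family of random variables that is jointly Gaussian and centered,
with covariance
`E[Z_H(t) Z_{H'}(s)] = (a_{H,H'} / 2) (|t|^{H+H'} + |s|^{H+H'} - |t-s|^{H+H'})`. -/
structure IsFractionalGaussianField {Ω : Type*} [MeasurableSpace Ω] (P : Measure Ω)
    (Z : Set.Ioo (0 : ℝ) 1 → ℝ≥0 → Ω → ℝ) : Prop where
  measurable : ∀ H t, Measurable (Z H t)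
  gaussian : IsGaussianProcess (fun p : Set.Ioo (0 : ℝ) 1 × ℝ≥0 => Z p.1 p.2) P
  centered : ∀ H t, ∫ ω, Z H t ω ∂P = 0
  covariance : ∀ (H H' : Set.Ioo (0 : ℝ) 1) (t s : ℝ≥0),
    ∫ ω, Z H t ω * Z H' s ω ∂P
      = fieldConst H H' / 2 *
        (|(t : ℝ)| ^ ((H : ℝ) + H') + |(s : ℝ)| ^ ((H : ℝ) + H')
          - |(t : ℝ) - s| ^ ((H : ℝ) + H'))

/-- The dual index `H' = 1 - H`. -/
def dualIndex (H : Set.Ioo (0 : ℝ) 1) : Set.Ioo (0 : ℝ) 1 :=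
  ⟨1 - H, sub_pos.2 H.2.2, sub_lt_self 1 H.2.1⟩

/-- The σ-algebra `ℱ_t^H = σ(Z_H(r) : 0 ≤ r ≤ t)`. -/
abbrev fieldSigma {Ω : Type*} (Z : Set.Ioo (0 : ℝ) 1 → ℝ≥0 → Ω → ℝ)
    (H : Set.Ioo (0 : ℝ) 1) (t : ℝ≥0) : MeasurableSpace Ω :=
  ⨆ r : ℝ≥0, ⨆ _ : r ≤ t, MeasurableSpace.comap (Z H r) inferInstance

/-- `M` is (a version of) the process `M_H`, that is, `M_H(t) = E[Z_{1-H}(t) | ℱ_t^H]` almost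
surely for every `t ≥ 0`. -/
def IsFieldMartingale {Ω : Type*} [MeasurableSpace Ω] (P : Measure Ω)
    (Z : Set.Ioo (0 : ℝ) 1 → ℝ≥0 → Ω → ℝ) (H : Set.Ioo (0 : ℝ) 1) (M : ℝ≥0 → Ω → ℝ) : Prop :=
  ∀ t : ℝ≥0, M t =ᵐ[P] condExp (fieldSigma Z H t) P (Z (dualIndex H) t)

/-- The constant `c_M = a_H² Γ(3/2-H) / (2H Γ(H+1/2) Γ(3-2H))`. -/
def martConst (H : ℝ) : ℝ :=
  dualConst H ^ 2 * Real.Gamma (3 / 2 - H)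
    / (2 * H * Real.Gamma (H + 1 / 2) * Real.Gamma (3 - 2 * H))

/-- The sum `∑_{i=1}^n (X(t_i) - X(t_{i-1}))²` with `t_i = i t / n`. -/
def sumSqIncrements {Ω : Type*} (X : ℝ≥0 → Ω → ℝ) (t : ℝ≥0) (n : ℕ) (ω : Ω) : ℝ :=
  ∑ i ∈ Finset.range n,
    (X (((i + 1 : ℕ) : ℝ≥0) * t / n) ω - X ((i : ℝ≥0) * t / n) ω) ^ 2

end

/-! For `r ≤ t` the covariance of `Z_H(r)` and `Z_{1-H}(t)` is `a_H r`, which does not depend on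
`t`. Since conditional expectation in a Gaussian space is orthogonal projection, `M_H(t)` is the
projection of `Z_{1-H}(t)` onto the closed span of `Z_H(r)`, `r ≤ t`. The increment `Z_{1-H}(t) -
Z_{1-H}(s)` is orthogonal to the span up to time `s`, so `M_H` has orthogonal, hence independent,
Gaussian increments (`inner_proj_proj`, `iIndepFun_proj_increment`).

The variance of `M_H(t)` comes from an explicit projection (`exists_projection_of_fractional_gram`).
On `[0, 1]` it is a multiple of the Wiener integral of `(u (1 - u)) ^ (1/2 - H)` against `Z_H`,
because this weight integrates the derivative of the covariance with `Z_H(s)` to a multiple of `s`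
(`integral_molchanWeight_mul_covDeriv`). That identity rests on an involution of `[0, 1]` exchanging
the two sides of `s` (`integral_ratioKernel_sub`). Scaling gives the variance `c_M t ^ (2 - 2H)`.

The sum of the squared increments therefore has mean exactly `c_M t ^ (2 - 2H)`, and each increment
has variance `O(n ^ (-(1 - H)))`. Bounds on the moment generating functions of centred Gaussian
squares then yield convergence in `L²` and almost surely (`tendsto_sum_sq_of_iIndepFun_gaussian`).
-/

/-! ### Real Beta integrals. -/

theorem ofReal_rpow_mul_one_sub_rpow {a b x : ℝ} (hx : x ∈ Set.Icc (0 : ℝ) 1) :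
    ((x ^ a * (1 - x) ^ b : ℝ) : ℂ) = (x : ℂ) ^ (a : ℂ) * (1 - (x : ℂ)) ^ (b : ℂ) := by
  rw [Complex.ofReal_mul, Complex.ofReal_cpow hx.1, Complex.ofReal_cpow (sub_nonneg.2 hx.2)]
  simp

theorem intervalIntegrable_rpow_mul_one_sub_rpow {a b : ℝ} (ha : -1 < a) (hb : -1 < b) :
    IntervalIntegrable (fun x : ℝ => x ^ a * (1 - x) ^ b) volume 0 1 := by
  have h := Complex.betaIntegral_convergent (u := ((a + 1 : ℝ) : ℂ)) (v := ((b + 1 : ℝ) : ℂ))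
    (by simpa using by linarith) (by simpa using by linarith)
  rw [intervalIntegrable_iff_integrableOn_Ioc_of_le zero_le_one] at h ⊢
  refine IntegrableOn.congr_fun h.re (fun x hx => ?_) measurableSet_Ioc
  have := ofReal_rpow_mul_one_sub_rpow (a := a) (b := b) (Set.Ioc_subset_Icc_self hx)
  simp only [Complex.ofReal_add, Complex.ofReal_one, add_sub_cancel_right]
  rw [← this]
  simp

theorem integral_rpow_mul_one_sub_rpow {a b : ℝ} (ha : -1 < a) (hb : -1 < b) :
    ∫ x in (0 : ℝ)..1, x ^ a * (1 - x) ^ b = beta (a + 1) (b + 1) := by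
  have h : Complex.betaIntegral ((a + 1 : ℝ) : ℂ) ((b + 1 : ℝ) : ℂ)
      = ((∫ x in (0 : ℝ)..1, x ^ a * (1 - x) ^ b : ℝ) : ℂ) := by
    rw [Complex.betaIntegral, ← intervalIntegral.integral_ofReal]
    refine intervalIntegral.integral_congr fun x hx => ?_
    rw [Set.uIcc_of_le zero_le_one] at hx
    have := ofReal_rpow_mul_one_sub_rpow (a := a) (b := b) hx
    simp only [Complex.ofReal_add, Complex.ofReal_one, add_sub_cancel_right]
    exact this.symm
  rw [beta_eq_betaIntegralReal _ _ (by linarith) (by linarith), h, Complex.ofReal_re]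

/-! ### The ratio kernel and its signed integral. -/

/-- The function `u ↦ (u (1 - u) / (u - s) ^ 2) ^ (-a)`. -/
noncomputable def ratioKernel (a s u : ℝ) : ℝ := u ^ (-a) * (1 - u) ^ (-a) * |u - s| ^ (2 * a)

/-- The sign of `a` decides where the kernel is singular: at `0` and `1` if `a ≥ 0`, at `s` if `a ≤
0`. In each case the remaining factor is at most `1`. -/
theorem intervalIntegrable_ratioKernel {a s : ℝ} (ha : |a| < 1 / 2) (hs : s ∈ Set.Icc (0 : ℝ) 1) :
    IntervalIntegrable (ratioKernel a s) volume 0 1 := by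
  obtain ⟨h1, h2⟩ := abs_lt.1 ha
  have hm1 : Measurable fun u : ℝ => |u - s| ^ (2 * a) := by fun_prop
  have hm2 : Measurable fun u : ℝ => u ^ (-a) * (1 - u) ^ (-a) := by fun_prop
  rcases le_total 0 a with h | h
  · have hi := intervalIntegrable_rpow_mul_one_sub_rpow (a := -a) (b := -a)
      (by linarith) (by linarith)
    rw [intervalIntegrable_iff_integrableOn_Ioc_of_le zero_le_one] at hi ⊢
    refine Integrable.mul_bdd (c := 1) hi hm1.aestronglyMeasurable ?_
    refine (ae_restrict_iff' measurableSet_Ioc).2 (ae_of_all _ fun u hu => ?_)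
    rw [Real.norm_of_nonneg (by positivity)]
    exact Real.rpow_le_one (abs_nonneg _)
      (abs_le.2 ⟨by linarith [hu.1, hs.2], by linarith [hu.2, hs.1]⟩) (by linarith)
  · have hi : IntervalIntegrable (fun u : ℝ => |u - s| ^ (2 * a)) volume 0 1 := by
      have hc : IntervalIntegrable (fun u : ℝ => |u| ^ (2 * a)) volume (0 - s) (1 - s) := by
        have h0 : ∀ c : ℝ, IntervalIntegrable (fun u : ℝ => |u| ^ (2 * a)) volume 0 c := by
          intro c
          have hpos : ∀ c : ℝ, 0 ≤ c →
              IntervalIntegrable (fun u : ℝ => |u| ^ (2 * a)) volume 0 c := by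
            intro c hc
            refine (intervalIntegral.intervalIntegrable_rpow' (r := 2 * a) (by linarith)).congr ?_
            intro u hu
            rw [Set.uIoc_of_le hc] at hu
            simp only [abs_of_pos hu.1]
          rcases le_total 0 c with hc | hc
          · exact hpos c hc
          · simpa using IntervalIntegrable.comp_sub_left (hpos (-c) (by linarith)) 0
        exact (h0 _).symm.trans (h0 _)
      simpa using hc.comp_sub_right s
    rw [intervalIntegrable_iff_integrableOn_Ioc_of_le zero_le_one] at hi ⊢
    refine Integrable.bdd_mul (c := 1) hi hm2.aestronglyMeasurable ?_
    refine (ae_restrict_iff' measurableSet_Ioc).2 (ae_of_all _ fun u hu => ?_)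
    have h0 : 0 ≤ 1 - u := by linarith [hu.2]
    have h0' := hu.1
    rw [Real.norm_of_nonneg (by positivity)]
    exact mul_le_one₀ (Real.rpow_le_one hu.1.le hu.2 (by linarith)) (by positivity)
      (Real.rpow_le_one h0 (by linarith) (by linarith))

section

variable {s : ℝ}

/-- The expression is affine in `u`, with values `s ^ 2` at `0` and `(1 - s) ^ 2` at `1`. -/
theorem ratioDenom_pos (hs : s ∈ Set.Ioo (0 : ℝ) 1) {u : ℝ} (hu : u ∈ Set.Icc (0 : ℝ) 1) :
    0 < s ^ 2 + (1 - 2 * s) * u := by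
  have h1 : 0 < s ^ 2 := pow_pos hs.1 2
  have h2 : 0 < (1 - s) ^ 2 := pow_pos (by linarith [hs.2]) 2
  rcases eq_or_lt_of_le hu.1 with h | h
  · rw [← h]; linarith
  · nlinarith [mul_nonneg (sub_nonneg.2 hu.2) h1.le, mul_pos h h2]

/-- The denominator equals `u (1 - u) + (u - s) ^ 2`. Writing `y` for its share `u (1 - u)`, the
kernel becomes a function of `y` alone. -/
theorem ratioKernel_eq (a : ℝ) (hs : s ∈ Set.Ioo (0 : ℝ) 1) {u : ℝ} (hu : u ∈ Set.Icc (0 : ℝ) 1) :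
    ratioKernel a s u = (u * (1 - u) / (s ^ 2 + (1 - 2 * s) * u)) ^ (-a)
      * (1 - u * (1 - u) / (s ^ 2 + (1 - 2 * s) * u)) ^ a := by
  have hD := ratioDenom_pos hs hu
  have h1 : 0 ≤ 1 - u := sub_nonneg.2 hu.2
  have h2 : 1 - u * (1 - u) / (s ^ 2 + (1 - 2 * s) * u)
      = |u - s| ^ 2 / (s ^ 2 + (1 - 2 * s) * u) := by
    rw [sq_abs, eq_div_iff hD.ne', sub_mul, div_mul_cancel₀ _ hD.ne']; ring
  rw [h2, Real.div_rpow (mul_nonneg hu.1 h1) hD.le, Real.div_rpow (by positivity) hD.le,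
    Real.mul_rpow hu.1 h1, ratioKernel, Real.rpow_mul (abs_nonneg _), Real.rpow_two,
    Real.rpow_neg hD.le]
  have := (Real.rpow_pos_of_pos hD a).ne'
  generalize (s ^ 2 + (1 - 2 * s) * u) ^ a = E at *
  field_simp

/-- The map `σ` exchanges `[0, s]` and `[s, 1]`, reverses orientation and preserves `y`, hence the
kernel, so the difference is the integral over `[0, s]` of the kernel times `1 + σ'`. As `1 + σ' =
(2 s - 1) y'` and `y` runs from `0` to `1`, the substitution `y` leaves a Beta integral. -/
theorem integral_ratioKernel_sub {a : ℝ} (ha : |a| < 1 / 2) (hs : s ∈ Set.Ioo (0 : ℝ) 1) :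
    (∫ u in (0 : ℝ)..s, ratioKernel a s u) - ∫ u in s..1, ratioKernel a s u
      = (2 * s - 1) * beta (1 - a) (1 + a) := by
  obtain ⟨h1, h2⟩ := abs_lt.1 ha
  have hs0 := hs.1
  have hs1 := hs.2
  set D : ℝ → ℝ := fun u => s ^ 2 + (1 - 2 * s) * u with hDdef
  set y : ℝ → ℝ := fun u => u * (1 - u) / D u with hy
  set σ : ℝ → ℝ := fun u => s ^ 2 * (1 - u) / D u with hσ
  set g : ℝ → ℝ := fun y => y ^ (-a) * (1 - y) ^ a with hg
  have hD : ∀ u ∈ Set.Icc (0 : ℝ) 1, 0 < D u := fun u hu => ratioDenom_pos hs hu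
  have hker : ∀ u ∈ Set.Icc (0 : ℝ) 1, ratioKernel a s u = g (y u) :=
    fun u hu => ratioKernel_eq a hs hu
  have hsub : ∀ u ∈ Set.Icc 0 s, u ∈ Set.Icc (0 : ℝ) 1 := fun u hu => ⟨hu.1, hu.2.trans hs1.le⟩
  have hsub' : ∀ u ∈ Set.Ioo 0 s, u ∈ Set.Icc (0 : ℝ) 1 :=
    fun u hu => hsub u (Set.Ioo_subset_Icc_self hu)
  have hDd : ∀ u, HasDerivAt D (1 - 2 * s) u := fun u => by
    have h := ((hasDerivAt_id u).const_mul (1 - 2 * s)).const_add (s ^ 2)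
    rwa [mul_one] at h
  set σ' : ℝ → ℝ := fun u => - (s ^ 2 * (1 - s) ^ 2 / D u ^ 2) with hσ'
  set y' : ℝ → ℝ := fun u => (s - u) * (s + u - 2 * u * s) / D u ^ 2 with hy'
  have hσd : ∀ u ∈ Set.Icc (0 : ℝ) 1, HasDerivAt σ (σ' u) u := by
    intro u hu
    have h0 := (hD u hu).ne'
    refine ((((hasDerivAt_id u).const_sub 1).const_mul (s ^ 2)).div (hDd u) h0).congr_deriv ?_
    simp only [hσ', id]
    field_simp
    simp only [hDdef]
    ring
  have hyd : ∀ u ∈ Set.Icc (0 : ℝ) 1, HasDerivAt y (y' u) u := by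
    intro u hu
    have h0 := (hD u hu).ne'
    refine (((hasDerivAt_id u).fun_mul ((hasDerivAt_id u).const_sub 1)).div
      (hDd u) h0).congr_deriv ?_
    simp only [hy', id]
    field_simp
    simp only [hDdef]
    ring
  have hσ_mem : ∀ u ∈ Set.Icc 0 s, σ u ∈ Set.Icc s 1 := by
    intro u hu
    have h0 := hD u (hsub u hu)
    constructor
    · rw [hσ, le_div_iff₀ h0]
      simp only [hDdef]
      nlinarith [mul_nonneg (mul_nonneg hs0.le (sub_nonneg.2 hu.2)) (sub_nonneg.2 hs1.le)]
    · rw [hσ, div_le_one h0]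
      simp only [hDdef]
      nlinarith [mul_nonneg hu.1 (sq_nonneg (1 - s))]
  have hσ_mem' : ∀ u ∈ Set.Ioo 0 s, σ u ∈ Set.Ioo s 1 := by
    intro u hu
    have h0 := hD u (hsub' u hu)
    constructor
    · rw [hσ, lt_div_iff₀ h0]
      simp only [hDdef]
      nlinarith [mul_pos (mul_pos hs0 (sub_pos.2 hu.2)) (sub_pos.2 hs1)]
    · rw [hσ, div_lt_one h0]
      simp only [hDdef]
      nlinarith [mul_pos hu.1 (pow_pos (sub_pos.2 hs1) 2)]
  have hyσ : ∀ u ∈ Set.Icc 0 s, y (σ u) = y u := by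
    intro u hu
    have h0 := hD u (hsub u hu)
    have hσm := hσ_mem u hu
    have h3 := hD (σ u) ⟨hs0.le.trans hσm.1, hσm.2⟩
    have e1 : D (σ u) = s ^ 2 * (1 - s) ^ 2 / D u := by
      change s ^ 2 + (1 - 2 * s) * (s ^ 2 * (1 - u) / D u) = _
      field_simp
      simp only [hDdef]
      ring
    have e2 : 1 - σ u = (1 - s) ^ 2 * u / D u := by
      simp only [hσ]
      field_simp
      simp only [hDdef]
      ring
    have h4 : (1 - s) ≠ 0 := by linarith
    simp only [hy]
    rw [e1, e2]
    simp only [hσ]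
    field_simp
  have hint := intervalIntegrable_ratioKernel ha ⟨hs0.le, hs1.le⟩
  have hint1 : IntervalIntegrable (ratioKernel a s) volume 0 s := by
    refine hint.mono_set ?_
    rw [Set.uIcc_of_le hs0.le, Set.uIcc_of_le zero_le_one]
    exact Set.Icc_subset_Icc_right hs1.le
  have hint2 : IntervalIntegrable (ratioKernel a s) volume s 1 := by
    refine hint.mono_set ?_
    rw [Set.uIcc_of_le hs1.le, Set.uIcc_of_le zero_le_one]
    exact Set.Icc_subset_Icc_left hs0.le
  have hDc : Continuous D := by fun_prop
  have hσ'c : ContinuousOn σ' (Set.uIcc 0 s) := by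
    rw [Set.uIcc_of_le hs0.le]
    refine (ContinuousOn.div (by fun_prop) (by fun_prop) fun u hu => ?_).neg
    exact pow_ne_zero 2 (hD u (hsub u hu)).ne'
  have hy'c : ContinuousOn y' (Set.uIcc 0 s) := by
    rw [Set.uIcc_of_le hs0.le]
    refine ContinuousOn.div (by fun_prop) (by fun_prop) fun u hu => ?_
    exact pow_ne_zero 2 (hD u (hsub u hu)).ne'
  have hkσ : ∀ u ∈ Set.Icc 0 s, ratioKernel a s (σ u) = ratioKernel a s u := by
    intro u hu
    have hσm := hσ_mem u hu
    rw [hker _ ⟨hs0.le.trans hσm.1, hσm.2⟩, hker _ (hsub u hu), hyσ u hu]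
  have hσ0 : σ 0 = 1 := by simp only [hσ, hDdef]; field_simp; ring
  have hσs : σ s = s := by
    have := hD s ⟨hs0.le, hs1.le⟩
    simp only [hσ, hDdef] at this ⊢
    rw [div_eq_iff this.ne']; ring
  have hy0 : y 0 = 0 := by simp [hy]
  have hys : y s = 1 := by
    have := hD s ⟨hs0.le, hs1.le⟩
    simp only [hy, hDdef] at this ⊢
    rw [div_eq_iff this.ne']; ring
  have hB : ∫ u in (0 : ℝ)..s, ratioKernel a s u * σ' u = - ∫ u in s..1, ratioKernel a s u := by
    have := intervalIntegral.integral_comp_mul_deriv''' (a := 0) (b := s) (f := σ) (f' := σ')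
      (g := ratioKernel a s) ?_ ?_ ?_ ?_ ?_
    · rw [hσ0, hσs] at this
      rw [← intervalIntegral.integral_symm, ← this]
      refine intervalIntegral.integral_congr fun u hu => ?_
      rw [Set.uIcc_of_le hs0.le] at hu
      simp only [Function.comp, hkσ u hu]
    · rw [Set.uIcc_of_le hs0.le]
      exact fun u hu => (hσd u (hsub u hu)).continuousAt.continuousWithinAt
    · rw [min_eq_left hs0.le, max_eq_right hs0.le]
      exact fun u hu => (hσd u (hsub' u hu)).hasDerivWithinAt
    · rw [min_eq_left hs0.le, max_eq_right hs0.le]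
      rintro _ ⟨u, hu, rfl⟩
      obtain ⟨h5, h6⟩ := hσ_mem' u hu
      refine ContinuousAt.continuousWithinAt ?_
      refine ((ContinuousAt.rpow_const (by fun_prop) (Or.inl ?_)).mul
        (ContinuousAt.rpow_const (by fun_prop) (Or.inl ?_))).mul
        (ContinuousAt.rpow_const (by fun_prop) (Or.inl ?_))
      · linarith
      · linarith
      · exact (abs_pos.2 (by linarith)).ne'
    · rw [Set.uIcc_of_le hs0.le]
      have h5 : IntegrableOn (ratioKernel a s) (Set.Icc s 1) := by
        rw [integrableOn_Icc_iff_integrableOn_Ioc,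
          ← intervalIntegrable_iff_integrableOn_Ioc_of_le hs1.le]
        exact hint2
      refine h5.mono_set ?_
      rintro _ ⟨u, hu, rfl⟩
      exact hσ_mem u hu
    · rw [Set.uIcc_of_le hs0.le]
      have h5 := hint1.mul_continuousOn hσ'c
      rw [intervalIntegrable_iff_integrableOn_Icc_of_le hs0.le] at h5
      refine h5.congr_fun (fun u hu => ?_) measurableSet_Icc
      simp only [Function.comp, hkσ u hu]
  have hg_int : IntegrableOn g (Set.Icc 0 1) := by
    rw [← intervalIntegrable_iff_integrableOn_Icc_of_le zero_le_one]
    exact intervalIntegrable_rpow_mul_one_sub_rpow (by linarith) (by linarith)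
  have hone : ∀ u ∈ Set.Icc (0 : ℝ) 1, 1 - y u = (u - s) ^ 2 / D u := by
    intro u hu
    have h0 := hD u hu
    simp only [hy]
    field_simp
    simp only [hDdef]
    ring
  have hy_mem : ∀ u ∈ Set.Icc (0 : ℝ) 1, y u ∈ Set.Icc (0 : ℝ) 1 := by
    intro u hu
    have h0 := hD u hu
    refine ⟨div_nonneg (mul_nonneg hu.1 (sub_nonneg.2 hu.2)) h0.le, ?_⟩
    have : 0 ≤ 1 - y u := by rw [hone u hu]; positivity
    linarith
  have hC : ∫ u in (0 : ℝ)..s, ratioKernel a s u * y' u = beta (1 - a) (1 + a) := by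
    have := intervalIntegral.integral_comp_mul_deriv''' (a := 0) (b := s) (f := y) (f' := y')
      (g := g) ?_ ?_ ?_ ?_ ?_
    · rw [hy0, hys, hg, integral_rpow_mul_one_sub_rpow (by linarith) (by linarith),
        show -a + 1 = 1 - a by ring, add_comm a 1] at this
      rw [← this]
      refine intervalIntegral.integral_congr fun u hu => ?_
      rw [Set.uIcc_of_le hs0.le] at hu
      simp only [hker u (hsub u hu), hg, Function.comp]
    · rw [Set.uIcc_of_le hs0.le]
      exact fun u hu => (hyd u (hsub u hu)).continuousAt.continuousWithinAt
    · rw [min_eq_left hs0.le, max_eq_right hs0.le]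
      exact fun u hu => (hyd u (hsub' u hu)).hasDerivWithinAt
    · rw [min_eq_left hs0.le, max_eq_right hs0.le]
      rintro _ ⟨u, hu, rfl⟩
      have h0 := hD u (hsub' u hu)
      refine ContinuousAt.continuousWithinAt ?_
      refine (ContinuousAt.rpow_const (by fun_prop) (Or.inl ?_)).mul
        (ContinuousAt.rpow_const (by fun_prop) (Or.inl ?_))
      · exact (div_pos (mul_pos hu.1 (by linarith [hu.2])) h0).ne'
      · rw [hone u (hsub' u hu)]
        exact (div_pos (sq_pos_of_ne_zero (by linarith [hu.2])) h0).ne'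
    · rw [Set.uIcc_of_le hs0.le]
      refine hg_int.mono_set ?_
      rintro _ ⟨u, hu, rfl⟩
      exact hy_mem u (hsub u hu)
    · rw [Set.uIcc_of_le hs0.le]
      have h5 := hint1.mul_continuousOn hy'c
      rw [intervalIntegrable_iff_integrableOn_Icc_of_le hs0.le] at h5
      refine h5.congr_fun (fun u hu => ?_) measurableSet_Icc
      simp only [Function.comp, hker u (hsub u hu)]
  rw [sub_eq_add_neg, ← hB, ← hC, ← intervalIntegral.integral_const_mul,
    ← intervalIntegral.integral_add hint1 (hint1.mul_continuousOn hσ'c)]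
  refine intervalIntegral.integral_congr fun u hu => ?_
  rw [Set.uIcc_of_le hs0.le] at hu
  have h0 := hD u (hsub u hu)
  have : 1 + σ' u = (2 * s - 1) * y' u := by
    simp only [hσ', hy']
    field_simp
    simp only [hDdef]
    ring
  show ratioKernel a s u + ratioKernel a s u * σ' u = (2 * s - 1) * (ratioKernel a s u * y' u)
  linear_combination ratioKernel a s u * this

end

theorem intervalIntegrable_sign_mul_ratioKernel {a s : ℝ} (ha : |a| < 1 / 2)
    (hs : s ∈ Set.Icc (0 : ℝ) 1) :
    IntervalIntegrable (fun u => SignType.sign (s - u) * ratioKernel a s u) volume 0 1 := by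
  have hint := intervalIntegrable_ratioKernel ha hs
  rw [intervalIntegrable_iff_integrableOn_Ioc_of_le zero_le_one] at hint ⊢
  refine Integrable.bdd_mul (c := 1) hint ?_ (ae_of_all _ fun u => ?_)
  · have : (fun u : ℝ => (SignType.sign (s - u) : ℝ))
        = fun u => if u < s then 1 else if s < u then -1 else 0 := by
      funext u
      rw [sign_apply]
      simp only [sub_pos, sub_neg]
      split_ifs <;> simp
    rw [this]
    exact (Measurable.ite measurableSet_Iio measurable_const
      (Measurable.ite measurableSet_Ioi measurable_const measurable_const)).aestronglyMeasurable
  · rcases lt_trichotomy (s - u) 0 with h | h | h <;> simp [h]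

theorem integral_sign_mul_ratioKernel {a s : ℝ} (ha : |a| < 1 / 2) (hs : s ∈ Set.Icc (0 : ℝ) 1) :
    ∫ u in (0 : ℝ)..1, SignType.sign (s - u) * ratioKernel a s u
      = (2 * s - 1) * beta (1 - a) (1 + a) := by
  obtain ⟨h1, h2⟩ := abs_lt.1 ha
  have hL : ∫ u in (0 : ℝ)..s, SignType.sign (s - u) * ratioKernel a s u
      = ∫ u in (0 : ℝ)..s, ratioKernel a s u := by
    refine intervalIntegral.integral_congr_ae ?_
    filter_upwards [compl_mem_ae_iff.2 (measure_singleton s)] with u hu hu'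
    rw [Set.uIoc_of_le hs.1] at hu'
    simp [sign_pos (sub_pos.2 (lt_of_le_of_ne hu'.2 hu))]
  have hR : ∫ u in s..1, SignType.sign (s - u) * ratioKernel a s u
      = -∫ u in s..1, ratioKernel a s u := by
    rw [← intervalIntegral.integral_neg]
    refine intervalIntegral.integral_congr_ae (ae_of_all _ fun u hu' => ?_)
    rw [Set.uIoc_of_le hs.2] at hu'
    simp [sign_neg (sub_neg.2 hu'.1)]
  have hint' := intervalIntegrable_sign_mul_ratioKernel ha hs
  have h01 : Set.uIcc (0 : ℝ) 1 = Set.Icc 0 1 := Set.uIcc_of_le zero_le_one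
  rw [← intervalIntegral.integral_add_adjacent_intervals (b := s)
      (hint'.mono_set (by rw [h01, Set.uIcc_of_le hs.1]; exact Set.Icc_subset_Icc_right hs.2))
      (hint'.mono_set (by rw [h01, Set.uIcc_of_le hs.2]; exact Set.Icc_subset_Icc_left hs.1)),
    hL, hR, ← sub_eq_add_neg]
  -- At `s = 0` and `s = 1` the involution degenerates, but two factors of the kernel merge and give
  -- a Beta integral directly.
  rcases eq_or_lt_of_le hs.1 with h0 | h0
  · subst h0
    have : ∫ u in (0 : ℝ)..1, ratioKernel a 0 u = beta (1 + a) (1 - a) := by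
      rw [add_comm, ← neg_add_eq_sub, add_comm (-a) 1, add_comm 1 (-a),
        ← integral_rpow_mul_one_sub_rpow (by linarith) (by linarith)]
      refine intervalIntegral.integral_congr_ae (ae_of_all _ fun u hu => ?_)
      rw [Set.uIoc_of_le zero_le_one] at hu
      rw [ratioKernel, sub_zero, abs_of_pos hu.1, mul_right_comm, ← Real.rpow_add hu.1]
      ring_nf
    rw [this, intervalIntegral.integral_same]
    simp only [beta]
    ring_nf
  · rcases eq_or_lt_of_le hs.2 with h3 | h3
    · subst h3
      have : ∫ u in (0 : ℝ)..1, ratioKernel a 1 u = beta (1 - a) (1 + a) := by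
        rw [← neg_add_eq_sub, add_comm 1 a,
          ← integral_rpow_mul_one_sub_rpow (by linarith) (by linarith)]
        refine intervalIntegral.integral_congr_ae ?_
        filter_upwards [compl_mem_ae_iff.2 (measure_singleton (1 : ℝ))] with u hu' hu
        rw [Set.uIoc_of_le zero_le_one] at hu
        have hu1 : 0 < 1 - u := sub_pos.2 (lt_of_le_of_ne hu.2 hu')
        rw [ratioKernel, abs_sub_comm, abs_of_pos hu1, mul_assoc, ← Real.rpow_add hu1]
        ring_nf
      rw [this, intervalIntegral.integral_same]
      ring
    · exact integral_ratioKernel_sub ha ⟨h0, h3⟩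

/-! ### The Molchan weight against the fractional covariance. -/

/-- The derivative in `u` of the covariance `(u ^ (2H) + s ^ (2H) - |u - s| ^ (2H)) / 2`. -/
noncomputable def covDeriv (H s u : ℝ) : ℝ :=
  H * (u ^ (2 * H - 1) + SignType.sign (s - u) * |u - s| ^ (2 * H - 1))

/-- The weight `(u (1 - u)) ^ (1/2 - H)`, as a product of two powers. -/
noncomputable def molchanWeight (H u : ℝ) : ℝ := u ^ (1 / 2 - H) * (1 - u) ^ (1 / 2 - H)

theorem molchanWeight_mul_covDeriv {H s u : ℝ} (hu : 0 < u) :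
    molchanWeight H u * covDeriv H s u = H * (u ^ (H - 1 / 2) * (1 - u) ^ (1 / 2 - H)
      + SignType.sign (s - u) * ratioKernel (H - 1 / 2) s u) := by
  have h : u ^ (H - 1 / 2) = u ^ (1 / 2 - H) * u ^ (2 * H - 1) := by
    rw [← Real.rpow_add hu]; ring_nf
  rw [h, molchanWeight, covDeriv, ratioKernel]
  ring_nf

theorem intervalIntegrable_molchanWeight_mul_covDeriv {H s : ℝ} (hH : H ∈ Set.Ioo (0 : ℝ) 1)
    (hs : s ∈ Set.Icc (0 : ℝ) 1) :
    IntervalIntegrable (fun u => molchanWeight H u * covDeriv H s u) volume 0 1 := by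
  have ha : |H - 1 / 2| < 1 / 2 := abs_lt.2 ⟨by linarith [hH.1], by linarith [hH.2]⟩
  refine IntervalIntegrable.congr ?_ (((intervalIntegrable_rpow_mul_one_sub_rpow
    (a := H - 1 / 2) (b := 1 / 2 - H) (by linarith [hH.1]) (by linarith [hH.2])).add
    (intervalIntegrable_sign_mul_ratioKernel ha hs)).const_mul H)
  intro u hu
  rw [Set.uIoc_of_le zero_le_one] at hu
  exact (molchanWeight_mul_covDeriv hu.1).symm

/-- Both terms of the integrand produce the same Beta value, with coefficients `1` and `2 s - 1`;
the constants cancel and only a multiple of `s` remains. The Beta arguments add up to `2`, so its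
denominator is `Γ(2) = 1`. -/
theorem integral_molchanWeight_mul_covDeriv {H s : ℝ} (hH : H ∈ Set.Ioo (0 : ℝ) 1)
    (hs : s ∈ Set.Icc (0 : ℝ) 1) :
    ∫ u in (0 : ℝ)..1, molchanWeight H u * covDeriv H s u
      = 2 * H * Real.Gamma (3 / 2 - H) * Real.Gamma (H + 1 / 2) * s := by
  have ha : |H - 1 / 2| < 1 / 2 := abs_lt.2 ⟨by linarith [hH.1], by linarith [hH.2]⟩
  have h : ∫ u in (0 : ℝ)..1, molchanWeight H u * covDeriv H s u
      = ∫ u in (0 : ℝ)..1, H * (u ^ (H - 1 / 2) * (1 - u) ^ (1 / 2 - H)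
      + SignType.sign (s - u) * ratioKernel (H - 1 / 2) s u) := by
    refine intervalIntegral.integral_congr_ae (ae_of_all _ fun u hu => ?_)
    rw [Set.uIoc_of_le zero_le_one] at hu
    exact molchanWeight_mul_covDeriv hu.1
  rw [h, intervalIntegral.integral_const_mul, intervalIntegral.integral_add
    (intervalIntegrable_rpow_mul_one_sub_rpow (by linarith [hH.1]) (by linarith [hH.2]))
    (intervalIntegrable_sign_mul_ratioKernel ha hs), integral_sign_mul_ratioKernel ha hs,
    integral_rpow_mul_one_sub_rpow (by linarith [hH.1]) (by linarith [hH.2]), beta, beta,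
    show H - 1 / 2 + 1 = H + 1 / 2 by ring, show 1 / 2 - H + 1 = 3 / 2 - H by ring,
    show 1 - (H - 1 / 2) = 3 / 2 - H by ring, show 1 + (H - 1 / 2) = H + 1 / 2 by ring,
    show H + 1 / 2 + (3 / 2 - H) = 2 by ring, show 3 / 2 - H + (H + 1 / 2) = 2 by ring,
    Real.Gamma_two]
  ring

theorem integral_molchanWeight {H : ℝ} (hH : H < 3 / 2) :
    ∫ u in (0 : ℝ)..1, molchanWeight H u
      = Real.Gamma (3 / 2 - H) ^ 2 / Real.Gamma (3 - 2 * H) := by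
  have h := integral_rpow_mul_one_sub_rpow (a := 1 / 2 - H) (b := 1 / 2 - H)
    (by linarith) (by linarith)
  rw [beta, show 1 / 2 - H + 1 = 3 / 2 - H by ring,
    show 3 / 2 - H + (3 / 2 - H) = 3 - 2 * H by ring, ← sq] at h
  exact h

theorem intervalIntegrable_molchanWeight {H : ℝ} (hH : H < 3 / 2) :
    IntervalIntegrable (molchanWeight H) volume 0 1 :=
  intervalIntegrable_rpow_mul_one_sub_rpow (by linarith) (by linarith)

theorem hasDerivAt_fractionalCov {H s u : ℝ} (hu : 0 < u) (hus : u ≠ s) :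
    HasDerivAt (fun u => (u ^ (2 * H) + s ^ (2 * H) - |u - s| ^ (2 * H)) / 2)
      (covDeriv H s u) u := by
  have h1 : HasDerivAt (fun u : ℝ => u ^ (2 * H)) (2 * H * u ^ (2 * H - 1)) u :=
    Real.hasDerivAt_rpow_const (Or.inl hu.ne')
  have h2 : HasDerivAt (fun u : ℝ => |u - s| ^ (2 * H))
      (2 * H * (SignType.sign (u - s) * |u - s| ^ (2 * H - 1))) u := by
    have h3 : HasDerivAt (fun u : ℝ => |u - s|) (SignType.sign (u - s) * 1) u :=
      HasDerivAt.comp u (h₂ := fun x : ℝ => |x|) (h := fun u => u - s)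
        (hasDerivAt_abs (sub_ne_zero.2 hus)) ((hasDerivAt_id u).sub_const s)
    refine (h3.rpow_const (p := 2 * H) (Or.inl ?_)).congr_deriv (by ring)
    exact (abs_pos.2 (sub_ne_zero.2 hus)).ne'
  refine (((h1.add_const (s ^ (2 * H))).sub h2).div_const 2).congr_deriv ?_
  have h4 : (SignType.sign (s - u) : ℝ) = - SignType.sign (u - s) := by
    rw [← neg_sub u s, Left.sign_neg, SignType.coe_neg]
  rw [covDeriv, h4]
  ring

/-! ### Integration by parts against the singular weight. -/

/-- Minus the derivative of `molchanWeight H`. -/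
noncomputable def molchanWeightDeriv (H u : ℝ) : ℝ :=
  (H - 1 / 2) * (1 - 2 * u) * (u ^ (-1 / 2 - H) * (1 - u) ^ (-1 / 2 - H))

theorem hasDerivAt_molchanWeight {H u : ℝ} (hu : u ∈ Set.Ioo (0 : ℝ) 1) :
    HasDerivAt (molchanWeight H) (-molchanWeightDeriv H u) u := by
  have hu1 : 0 < 1 - u := sub_pos.2 hu.2
  have h1 : HasDerivAt (fun u : ℝ => u ^ (1 / 2 - H)) ((1 / 2 - H) * u ^ (1 / 2 - H - 1)) u :=
    Real.hasDerivAt_rpow_const (Or.inl hu.1.ne')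
  have h2 : HasDerivAt (fun u : ℝ => (1 - u) ^ (1 / 2 - H))
      (-1 * (1 / 2 - H) * (1 - u) ^ (1 / 2 - H - 1)) u :=
    ((hasDerivAt_id u).const_sub 1).rpow_const (Or.inl hu1.ne')
  refine (h1.mul h2).congr_deriv ?_
  have e : ∀ x : ℝ, 0 < x → x ^ (1 / 2 - H) = x * x ^ (-1 / 2 - H) := by
    intro x hx
    nth_rw 2 [← Real.rpow_one x]
    rw [← Real.rpow_add hx]
    ring_nf
  rw [e u hu.1, e (1 - u) hu1, molchanWeightDeriv, show 1 / 2 - H - 1 = -1 / 2 - H by ring]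
  ring

theorem molchanWeight_one_sub (H u : ℝ) : molchanWeight H (1 - u) = molchanWeight H u := by
  rw [molchanWeight, molchanWeight, sub_sub_cancel, mul_comm]

theorem rpow_le_two_of_mem_Icc {x p : ℝ} (hx : x ∈ Set.Icc (1 / 2 : ℝ) 1) (hp : -1 ≤ p) :
    x ^ p ≤ 2 := by
  have hx0 : 0 < x := lt_of_lt_of_le (by norm_num) hx.1
  calc x ^ p ≤ x ^ (-1 : ℝ) := Real.rpow_le_rpow_of_exponent_ge hx0 hx.2 hp
    _ = x⁻¹ := Real.rpow_neg_one x
    _ ≤ 2 := by rw [inv_le_comm₀ hx0 two_pos]; simpa using hx.1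

theorem abs_molchanWeightDeriv_le {H r : ℝ} (hH : H ∈ Set.Ioo (0 : ℝ) 1)
    (hr : r ∈ Set.Ioc (0 : ℝ) (1 / 2)) :
    |molchanWeightDeriv H r| ≤ 2 * r ^ (-1 / 2 - H) := by
  have hr0 := hr.1
  have h1 : 0 < 1 - r := by linarith [hr.2]
  have h2 : (1 - r) ^ (-1 / 2 - H) ≤ 4 := by
    -- The exponent can be below `-1`, so it is halved before applying `rpow_le_two_of_mem_Icc`.
    rw [show -1 / 2 - H = (-1 / 4 - H / 2) + (-1 / 4 - H / 2) by ring, Real.rpow_add h1]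
    have h3 : (1 - r) ^ (-1 / 4 - H / 2) ≤ 2 :=
      rpow_le_two_of_mem_Icc ⟨by linarith [hr.2], by linarith⟩ (by linarith [hH.2])
    have h4 : 0 ≤ (1 - r) ^ (-1 / 4 - H / 2) := by positivity
    nlinarith
  have h5 : |(H - 1 / 2) * (1 - 2 * r)| ≤ 1 / 2 := by
    rw [abs_mul]
    have h6 : |H - 1 / 2| ≤ 1 / 2 := abs_le.2 ⟨by linarith [hH.1], by linarith [hH.2]⟩
    have h7 : |1 - 2 * r| ≤ 1 := abs_le.2 ⟨by linarith [hr.2], by linarith⟩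
    nlinarith [abs_nonneg (H - 1 / 2), abs_nonneg (1 - 2 * r)]
  have h8 : 0 ≤ r ^ (-1 / 2 - H) := by positivity
  have h9 : 0 ≤ (1 - r) ^ (-1 / 2 - H) := by positivity
  rw [molchanWeightDeriv, abs_mul, abs_of_nonneg (mul_nonneg h8 h9)]
  calc |(H - 1 / 2) * (1 - 2 * r)| * (r ^ (-1 / 2 - H) * (1 - r) ^ (-1 / 2 - H))
      ≤ 1 / 2 * (r ^ (-1 / 2 - H) * 4) := by gcongr
    _ = _ := by ring

theorem continuousOn_of_norm_sub_le_rpow {E : Type*} [NormedAddCommGroup E] {f : ℝ → E}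
    {K H : ℝ} (hH : 0 < H) {s : Set ℝ}
    (hf : ∀ a ∈ s, ∀ b ∈ s, ‖f a - f b‖ ≤ K * |a - b| ^ H) : ContinuousOn f s := by
  intro b hb
  rw [ContinuousWithinAt, tendsto_iff_norm_sub_tendsto_zero]
  have h : Tendsto (fun a => K * |a - b| ^ H) (𝓝[s] b) (𝓝 0) := by
    have : ContinuousAt (fun a => K * |a - b| ^ H) b :=
      continuousAt_const.mul (ContinuousAt.rpow_const (by fun_prop) (Or.inr hH.le))
    have h := this.tendsto
    simp only [sub_self, abs_zero, Real.zero_rpow hH.ne', mul_zero] at h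
    exact h.mono_left nhdsWithin_le_nhds
  refine squeeze_zero' (Eventually.of_forall fun _ => norm_nonneg _) ?_ h
  exact eventually_mem_nhdsWithin.mono fun a ha => hf a ha b hb

/-- The decay `r ^ H` of `g` reduces the singularity `r ^ (-1/2 - H)` to the integrable `r ^
(-1/2)`, for every `H` in `(0, 1)`. -/
theorem intervalIntegrable_molchanWeightDeriv_smul {E : Type*} [NormedAddCommGroup E]
    [NormedSpace ℝ E] {H C : ℝ} (hH : H ∈ Set.Ioo (0 : ℝ) 1) {g : ℝ → E}
    (hg : ContinuousOn g (Set.Ioc 0 (1 / 2))) (hC : ∀ r ∈ Set.Ioc (0 : ℝ) (1 / 2), ‖g r‖ ≤ C * r ^ H) :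
    IntervalIntegrable (fun r => molchanWeightDeriv H r • g r) volume 0 (1 / 2) := by
  have hb : IntervalIntegrable (fun r : ℝ => 2 * C * r ^ (-1 / 2 : ℝ)) volume 0 (1 / 2) :=
    (intervalIntegral.intervalIntegrable_rpow' (by norm_num)).const_mul _
  rw [intervalIntegrable_iff_integrableOn_Ioc_of_le (by norm_num)] at hb ⊢
  refine Integrable.mono' hb ?_ ?_
  · refine ContinuousOn.aestronglyMeasurable ?_ measurableSet_Ioc
    refine ContinuousOn.smul (fun r hr => ContinuousAt.continuousWithinAt ?_) hg
    have h0 := hr.1.ne'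
    have h1 : 1 - r ≠ 0 := by linarith [hr.2]
    exact (by fun_prop : ContinuousAt (fun r : ℝ => (H - 1 / 2) * (1 - 2 * r)) r).mul
      ((ContinuousAt.rpow_const (by fun_prop) (Or.inl h0)).mul
      (ContinuousAt.rpow_const (by fun_prop) (Or.inl h1)))
  · refine (ae_restrict_iff' measurableSet_Ioc).2 (ae_of_all _ fun r hr => ?_)
    have h1 := abs_molchanWeightDeriv_le hH hr
    have h2 := hC r hr
    have hr0 := hr.1
    have h3 : 0 ≤ r ^ (-1 / 2 - H) := by positivity
    rw [norm_smul, Real.norm_eq_abs]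
    calc |molchanWeightDeriv H r| * ‖g r‖ ≤ (2 * r ^ (-1 / 2 - H)) * (C * r ^ H) := by gcongr
      _ = 2 * C * (r ^ (-1 / 2 - H) * r ^ H) := by ring
      _ = _ := by rw [← Real.rpow_add hr0]; ring_nf

/-- Bound on the folded function `r ↦ f r + f 1 - f (1 - r)` of a function that is Hölder
continuous with exponent `H` and vanishes at `0`. -/
theorem norm_fold_le {E : Type*} [NormedAddCommGroup E] {f : ℝ → E} {K H : ℝ}
    (hf0 : f 0 = 0)
    (hf : ∀ a ∈ Set.Icc (0 : ℝ) 1, ∀ b ∈ Set.Icc (0 : ℝ) 1, ‖f a - f b‖ ≤ K * |a - b| ^ H)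
    {r : ℝ} (hr : r ∈ Set.Icc (0 : ℝ) (1 / 2)) : ‖f r + f 1 - f (1 - r)‖ ≤ 2 * K * r ^ H := by
  have h1 := hf r ⟨hr.1, by linarith [hr.2]⟩ 0 (by simp)
  have h2 := hf 1 (by simp) (1 - r) ⟨by linarith [hr.2], by linarith [hr.1]⟩
  rw [hf0, sub_zero, sub_zero, abs_of_nonneg hr.1] at h1
  rw [sub_sub_cancel, abs_of_nonneg hr.1] at h2
  calc ‖f r + f 1 - f (1 - r)‖ = ‖f r + (f 1 - f (1 - r))‖ := by rw [add_sub_assoc]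
    _ ≤ _ := norm_add_le _ _
    _ ≤ _ := by linarith

theorem continuousOn_fold {E : Type*} [NormedAddCommGroup E] {f : ℝ → E}
    (hf : ContinuousOn f (Set.Icc 0 1)) :
    ContinuousOn (fun r => f r + f 1 - f (1 - r)) (Set.Icc 0 (1 / 2)) := by
  refine ((hf.mono (Set.Icc_subset_Icc_right (by norm_num))).add continuousOn_const).sub
    (hf.comp (by fun_prop) fun r hr => ?_)
  exact ⟨by linarith [hr.2], by linarith [hr.1]⟩

/-- **Integration by parts** for the weight `molchanWeight H` and a function `f` that is Hölder
continuous with exponent `H`, folded at the midpoint. -/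
theorem molchanWeight_integral_by_parts {H K : ℝ} (hH : H ∈ Set.Ioo (0 : ℝ) 1) {f f' : ℝ → ℝ}
    (hf0 : f 0 = 0)
    (hf : ∀ a ∈ Set.Icc (0 : ℝ) 1, ∀ b ∈ Set.Icc (0 : ℝ) 1, ‖f a - f b‖ ≤ K * |a - b| ^ H)
    {S : Set ℝ} (hS : S.Countable) (hf' : ∀ u ∈ Set.Ioo (0 : ℝ) 1 \ S, HasDerivAt f (f' u) u)
    (hint : IntervalIntegrable (fun u => molchanWeight H u * f' u) volume 0 1) :
    molchanWeight H (1 / 2) * f 1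
        + ∫ r in (0 : ℝ)..1 / 2, molchanWeightDeriv H r * (f r + f 1 - f (1 - r))
      = ∫ u in (0 : ℝ)..1, molchanWeight H u * f' u := by
  have hfc := continuousOn_of_norm_sub_le_rpow hH.1 hf
  have hgc := continuousOn_fold hfc
  have hgb := fun r hr => norm_fold_le hf0 hf (r := r) hr
  set g : ℝ → ℝ := fun r => f r + f 1 - f (1 - r) with hg
  have hhalf : (0 : ℝ) ≤ 1 / 2 := by norm_num
  have hint1 : IntervalIntegrable (fun r => molchanWeightDeriv H r * g r) volume 0 (1 / 2) :=
    intervalIntegrable_molchanWeightDeriv_smul hH (hgc.mono Set.Ioc_subset_Icc_self)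
      fun r hr => hgb r (Set.Ioc_subset_Icc_self hr)
  have hint1' : IntervalIntegrable (fun r => -(molchanWeightDeriv H r * g r)) volume 0 (1 / 2) :=
    hint1.neg
  have h01 : Set.uIcc (0 : ℝ) 1 = Set.Icc 0 1 := Set.uIcc_of_le zero_le_one
  have hint2 : IntervalIntegrable (fun u => molchanWeight H u * f' u) volume 0 (1 / 2) :=
    hint.mono_set (by
      rw [h01, Set.uIcc_of_le hhalf]; exact Set.Icc_subset_Icc_right (by norm_num))
  have hint3 : IntervalIntegrable (fun u => molchanWeight H u * f' u) volume (1 / 2) 1 :=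
    hint.mono_set (by
      rw [h01, Set.uIcc_of_le (by norm_num)]; exact Set.Icc_subset_Icc_left (by norm_num))
  have hint4 : IntervalIntegrable (fun u => molchanWeight H u * f' (1 - u)) volume 0 (1 / 2) := by
    have := (hint3.comp_sub_left 1).symm
    norm_num at this
    simpa only [molchanWeight_one_sub] using this
  have hfold : ∫ u in (1 / 2 : ℝ)..1, molchanWeight H u * f' u
      = ∫ u in (0 : ℝ)..1 / 2, molchanWeight H u * f' (1 - u) := by
    have := intervalIntegral.integral_comp_sub_left (a := 0) (b := 1 / 2)
      (fun u => molchanWeight H u * f' u) 1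
    norm_num [molchanWeight_one_sub] at this ⊢
    exact this.symm
  -- The weight is symmetric about `1/2`, so the two halves fold into one integral over `[0, 1/2]`
  -- against `g`. As `g` vanishes at `0`, one argument covers weights that vanish and weights that
  -- blow up at the endpoints. The boundary term at `1/2` is the weight times `g (1/2) = f 1`.
  have hFTC := MeasureTheory.integral_eq_of_hasDerivAt_off_countable_of_le
    (fun r => molchanWeight H r * g r)
    (fun r => -(molchanWeightDeriv H r * g r)
      + (molchanWeight H r * f' r + molchanWeight H r * f' (1 - r))) hhalf
    -- The reflected term `f (1 - r)` adds the mirror image of `S` to the exceptional set.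
    (hS.union (hS.preimage (sub_right_injective (b := (1 : ℝ))))) ?_ ?_
    (hint1'.add (hint2.add hint4))
  · rw [intervalIntegral.integral_add hint1' (hint2.add hint4),
      intervalIntegral.integral_add hint2 hint4, intervalIntegral.integral_neg, ← hfold,
      intervalIntegral.integral_add_adjacent_intervals hint2 hint3] at hFTC
    have e1 : g (1 / 2) = f 1 := by simp only [hg]; norm_num
    have e0 : g 0 = 0 := by simp [hg, hf0]
    simp only [e1, e0, mul_zero, sub_zero] at hFTC
    linarith
  -- At `0` the weight may be infinite in the limit; continuity there comes from `r ^ (1/2 - H) * r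
  -- ^ H = r ^ (1/2)`.
  · intro r hr
    rcases eq_or_lt_of_le hr.1 with h0 | h0
    · subst h0
      have e0 : g 0 = 0 := by simp [hg, hf0]
      rw [ContinuousWithinAt, e0, mul_zero]
      have hlim : Tendsto (fun r : ℝ => 4 * K * r ^ (1 / 2 : ℝ)) (𝓝[Set.Icc 0 (1 / 2)] 0) (𝓝 0) := by
        have : ContinuousAt (fun r : ℝ => 4 * K * r ^ (1 / 2 : ℝ)) 0 :=
          continuousAt_const.mul (ContinuousAt.rpow_const (by fun_prop) (Or.inr hhalf))
        have h := this.tendsto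
        rw [Real.zero_rpow (by norm_num), mul_zero] at h
        exact h.mono_left nhdsWithin_le_nhds
      refine squeeze_zero_norm' (eventually_mem_nhdsWithin.mono fun r hr => ?_) hlim
      rcases eq_or_lt_of_le hr.1 with h0 | h0
      · rw [← h0, e0]; simp
      · have h1 : 0 < 1 - r := by linarith [hr.2]
        have h2 : (1 - r) ^ (1 / 2 - H) ≤ 2 :=
          rpow_le_two_of_mem_Icc ⟨by linarith [hr.2], by linarith⟩ (by linarith [hH.2])
        have h3 := hgb r hr
        rw [norm_mul, molchanWeight, Real.norm_of_nonneg (by positivity)]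
        calc r ^ (1 / 2 - H) * (1 - r) ^ (1 / 2 - H) * ‖g r‖
            ≤ r ^ (1 / 2 - H) * 2 * (2 * K * r ^ H) := by gcongr
          _ = 4 * K * (r ^ (1 / 2 - H) * r ^ H) := by ring
          _ = _ := by rw [← Real.rpow_add h0]; ring_nf
    · exact ((hasDerivAt_molchanWeight ⟨h0, by linarith [hr.2]⟩).continuousAt.continuousWithinAt).mul
        (hgc r hr)
  · rintro r ⟨hr, hrS⟩
    rw [Set.mem_union, not_or] at hrS
    have h1 : HasDerivAt (fun r => f (1 - r)) (-f' (1 - r)) r := by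
      have := (hf' (1 - r) ⟨⟨by linarith [hr.2], by linarith [hr.1]⟩, hrS.2⟩).comp_const_sub 1 r
      exact this
    have h2 := ((hf' r ⟨⟨hr.1, by linarith [hr.2]⟩, hrS.1⟩).add_const (f 1)).sub h1
    refine ((hasDerivAt_molchanWeight ⟨hr.1, by linarith [hr.2]⟩).mul h2).congr_deriv ?_
    simp only [hg, Pi.sub_apply]
    ring

/-! ### The Wiener integral in a Hilbert space and the explicit projection. -/

section

variable {E : Type*} [NormedAddCommGroup E] [InnerProductSpace ℝ E] [CompleteSpace E]

/-- The Wiener integral `∫ molchanWeight H dz` over `[0, 1]`, folded at the midpoint and integrated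
by parts. -/
noncomputable def molchanElement (H : ℝ) (z : ℝ → E) : E :=
  molchanWeight H (1 / 2) • z 1
    + ∫ r in (0 : ℝ)..1 / 2, molchanWeightDeriv H r • (z r + z 1 - z (1 - r))

theorem inner_molchanElement {H K : ℝ} (hH : H ∈ Set.Ioo (0 : ℝ) 1) {z : ℝ → E} (hz0 : z 0 = 0)
    (hz : ∀ a ∈ Set.Icc (0 : ℝ) 1, ∀ b ∈ Set.Icc (0 : ℝ) 1, ‖z a - z b‖ ≤ K * |a - b| ^ H)
    (e : E) :
    inner ℝ e (molchanElement H z) = molchanWeight H (1 / 2) * inner ℝ e (z 1)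
      + ∫ r in (0 : ℝ)..1 / 2, molchanWeightDeriv H r
          * (inner ℝ e (z r) + inner ℝ e (z 1) - inner ℝ e (z (1 - r))) := by
  have hint : IntervalIntegrable
      (fun r => molchanWeightDeriv H r • (z r + z 1 - z (1 - r))) volume 0 (1 / 2) :=
    intervalIntegrable_molchanWeightDeriv_smul hH
      ((continuousOn_fold (continuousOn_of_norm_sub_le_rpow hH.1 hz)).mono
        Set.Ioc_subset_Icc_self)
      fun r hr => norm_fold_le hz0 hz (Set.Ioc_subset_Icc_self hr)
  have h := (innerSL ℝ e).intervalIntegral_comp_comm hint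
  simp only [innerSL_apply_apply] at h
  rw [molchanElement, inner_add_right, inner_smul_right, ← h]
  simp only [inner_smul_right, inner_sub_right, inner_add_right]

/-- A vector orthogonal to the curve kills every term of the pairing formula, so the element lies in
the double orthogonal complement, which is the closed span. -/
theorem molchanElement_mem_closure_span {H K : ℝ} (hH : H ∈ Set.Ioo (0 : ℝ) 1) {z : ℝ → E}
    (hz0 : z 0 = 0)
    (hz : ∀ a ∈ Set.Icc (0 : ℝ) 1, ∀ b ∈ Set.Icc (0 : ℝ) 1, ‖z a - z b‖ ≤ K * |a - b| ^ H) :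
    molchanElement H z ∈ (Submodule.span ℝ (z '' Set.Icc 0 1)).topologicalClosure := by
  rw [← Submodule.orthogonal_orthogonal_eq_closure, Submodule.mem_orthogonal]
  intro e he
  have h0 : ∀ u ∈ Set.Icc (0 : ℝ) 1, inner ℝ e (z u) = 0 := fun u hu =>
    (Submodule.mem_orthogonal' _ _).1 he _ (Submodule.subset_span ⟨u, hu, rfl⟩)
  rw [inner_molchanElement hH hz0 hz, h0 1 (by simp), mul_zero, zero_add]
  have : ∫ r in (0 : ℝ)..1 / 2, molchanWeightDeriv H r
      * (inner ℝ e (z r) + 0 - inner ℝ e (z (1 - r))) = ∫ r in (0 : ℝ)..1 / 2, 0 := by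
    refine intervalIntegral.integral_congr fun r hr => ?_
    rw [Set.uIcc_of_le (by norm_num)] at hr
    simp only [h0 r ⟨hr.1, by linarith [hr.2]⟩, h0 (1 - r) ⟨by linarith [hr.2], by linarith [hr.1]⟩]
    simp
  rw [this]
  simp

/-- For a curve `f : [0, 1] → ℝ` of the form `⟪e, z ·⟫`, pairing with `molchanElement` is
integration of `molchanWeight` against the derivative of `f`. -/
theorem inner_molchanElement_eq_integral {H K : ℝ} (hH : H ∈ Set.Ioo (0 : ℝ) 1) {z : ℝ → E}
    (hz0 : z 0 = 0)
    (hz : ∀ a ∈ Set.Icc (0 : ℝ) 1, ∀ b ∈ Set.Icc (0 : ℝ) 1, ‖z a - z b‖ ≤ K * |a - b| ^ H)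
    {e : E} {f f' : ℝ → ℝ} (hf : ∀ u ∈ Set.Icc (0 : ℝ) 1, inner ℝ e (z u) = f u)
    {S : Set ℝ} (hS : S.Countable) (hf' : ∀ u ∈ Set.Ioo (0 : ℝ) 1 \ S, HasDerivAt f (f' u) u)
    (hint : IntervalIntegrable (fun u => molchanWeight H u * f' u) volume 0 1) :
    inner ℝ e (molchanElement H z) = ∫ u in (0 : ℝ)..1, molchanWeight H u * f' u := by
  rw [← molchanWeight_integral_by_parts hH (K := ‖e‖ * K) ?_ ?_ hS hf' hint,
    inner_molchanElement hH hz0 hz, hf 1 (by simp)]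
  · congr 1
    refine intervalIntegral.integral_congr fun r hr => ?_
    rw [Set.uIcc_of_le (by norm_num)] at hr
    simp only [hf r ⟨hr.1, by linarith [hr.2]⟩, hf (1 - r) ⟨by linarith [hr.2], by linarith [hr.1]⟩]
  · rw [← hf 0 (by simp), hz0, inner_zero_right]
  · intro a ha b hb
    rw [← hf a ha, ← hf b hb, ← inner_sub_right, mul_assoc]
    exact (norm_inner_le_norm _ _).trans (by gcongr; exact hz a ha b hb)

/-- A curve whose Gram kernel is a multiple of the covariance of fractional Brownian motion, and a
vector `X` whose pairing with the curve is linear: the orthogonal projection of `X` onto the closed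
span of the curve. -/
theorem exists_projection_of_fractional_gram {H κ b : ℝ} (hH : H ∈ Set.Ioo (0 : ℝ) 1) (hκ : 0 < κ)
    {z : ℝ → E} (hz : ∀ u ∈ Set.Icc (0 : ℝ) 1, ∀ s ∈ Set.Icc (0 : ℝ) 1,
      inner ℝ (z s) (z u) = κ * ((u ^ (2 * H) + s ^ (2 * H) - |u - s| ^ (2 * H)) / 2))
    {X : E} (hX : ∀ u ∈ Set.Icc (0 : ℝ) 1, inner ℝ X (z u) = b * u) :
    ∃ p ∈ (Submodule.span ℝ (z '' Set.Icc 0 1)).topologicalClosure,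
      (∀ u ∈ Set.Icc (0 : ℝ) 1, inner ℝ (z u) (X - p) = 0) ∧
      inner ℝ X p = b ^ 2 / κ * (Real.Gamma (3 / 2 - H)
        / (2 * H * Real.Gamma (H + 1 / 2) * Real.Gamma (3 - 2 * H))) := by
  have hH0 := hH.1
  have h2H : 2 * H ≠ 0 := by linarith
  have hG1 : Real.Gamma (3 / 2 - H) ≠ 0 := (Real.Gamma_pos_of_pos (by linarith [hH.2])).ne'
  have hG2 : Real.Gamma (H + 1 / 2) ≠ 0 := (Real.Gamma_pos_of_pos (by linarith)).ne'
  have hG3 : Real.Gamma (3 - 2 * H) ≠ 0 := (Real.Gamma_pos_of_pos (by linarith [hH.2])).ne'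
  have hz0 : z 0 = 0 := by
    rw [← inner_self_eq_zero (𝕜 := ℝ), hz 0 (by simp) 0 (by simp)]
    simp [h2H]
  -- The Gram kernel gives equality: `‖z a - z b‖ ^ 2 = κ |a - b| ^ (2H)`.
  have hhol : ∀ a ∈ Set.Icc (0 : ℝ) 1, ∀ b ∈ Set.Icc (0 : ℝ) 1,
      ‖z a - z b‖ ≤ √κ * |a - b| ^ H := by
    intro a ha b hb
    refine le_of_eq ?_
    rw [← sq_eq_sq₀ (norm_nonneg _) (by positivity), mul_pow, Real.sq_sqrt hκ.le,
      ← Real.rpow_mul_natCast (abs_nonneg _), ← real_inner_self_eq_norm_sq, inner_sub_left,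
      inner_sub_right, inner_sub_right, hz a ha a ha, hz b hb b hb, hz a ha b hb, hz b hb a ha,
      abs_sub_comm b a]
    simp [h2H, mul_comm H 2]
    ring
  have h1 : ∀ s ∈ Set.Icc (0 : ℝ) 1, inner ℝ (z s) (molchanElement H z)
      = κ * (2 * H * Real.Gamma (3 / 2 - H) * Real.Gamma (H + 1 / 2) * s) := by
    intro s hs
    have hi := (intervalIntegrable_molchanWeight_mul_covDeriv hH hs).const_mul κ
    have e : ∀ u, κ * (molchanWeight H u * covDeriv H s u)
        = molchanWeight H u * (κ * covDeriv H s u) := fun u => by ring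
    simp only [e] at hi
    rw [inner_molchanElement_eq_integral hH hz0 hhol
      (f := fun u => κ * ((u ^ (2 * H) + s ^ (2 * H) - |u - s| ^ (2 * H)) / 2))
      (f' := fun u => κ * covDeriv H s u) (S := {s}) (fun u hu => hz u hu s hs)
      (Set.countable_singleton s) (fun u hu => (hasDerivAt_fractionalCov hu.1.1 hu.2).const_mul κ)
      hi, ← integral_molchanWeight_mul_covDeriv hH hs, ← intervalIntegral.integral_const_mul]
    simp only [e]
  have h2 : inner ℝ X (molchanElement H z)
      = Real.Gamma (3 / 2 - H) ^ 2 / Real.Gamma (3 - 2 * H) * b := by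
    rw [inner_molchanElement_eq_integral hH hz0 hhol (f := fun u => b * u) (f' := fun _ => b)
      (S := ∅) hX Set.countable_empty (fun u _ => by simpa using (hasDerivAt_id u).const_mul b)
      ((intervalIntegrable_molchanWeight (by linarith [hH.2])).mul_const b),
      intervalIntegral.integral_mul_const, integral_molchanWeight (by linarith [hH.2])]
  -- The pairings of `z s` with `molchanElement` and with `X` are both linear in `s`; the scalar is
  -- the ratio of their slopes.
  refine ⟨(b / (κ * (2 * H * Real.Gamma (3 / 2 - H) * Real.Gamma (H + 1 / 2)))) •
    molchanElement H z, Submodule.smul_mem _ _ (molchanElement_mem_closure_span hH hz0 hhol),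
    fun u hu => ?_, ?_⟩
  · rw [inner_sub_right, inner_smul_right, real_inner_comm, hX u hu, h1 u hu]
    generalize Real.Gamma (3 / 2 - H) = G at hG1 ⊢
    field_simp
    ring
  · rw [inner_smul_right, h2]
    field_simp

end

/-! ### Gaussian subspaces of `L²`. -/

section

variable {Ω : Type*} [MeasurableSpace Ω] {P : Measure Ω}

/-- A subspace of `L²` all of whose elements are centered Gaussian random variables. -/
def IsGaussianSubspace (P : Measure Ω) (V : Submodule ℝ (Lp ℝ 2 P)) : Prop :=
  ∀ U ∈ V, P.map U = gaussianReal 0 (‖U‖₊ ^ 2)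

theorem charFun_map_coeFn_Lp (U : Lp ℝ 2 P) (θ : ℝ) :
    charFun (P.map U) θ = ∫ ω, Complex.exp (θ * U ω * Complex.I) ∂P := by
  rw [charFun_apply_real, integral_map (Lp.aestronglyMeasurable U).aemeasurable]
  exact (by fun_prop : Measurable fun x : ℝ => Complex.exp (θ * x * Complex.I)).aestronglyMeasurable

/-- An `L²`-convergent sequence has an almost surely convergent subsequence, so characteristic
functions pass to the limit by dominated convergence; on the Gaussian side they depend continuously
on the norm. -/
theorem IsGaussianSubspace.topologicalClosure [IsProbabilityMeasure P] {V : Submodule ℝ (Lp ℝ 2 P)}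
    (hV : IsGaussianSubspace P V) : IsGaussianSubspace P V.topologicalClosure := by
  intro U hU
  obtain ⟨u, hu, hlim⟩ := mem_closure_iff_seq_limit.1 hU
  obtain ⟨ns, hns, hae⟩ := (tendstoInMeasure_of_tendsto_Lp hlim).exists_seq_tendsto_ae
  have : IsProbabilityMeasure (P.map U) :=
    Measure.isProbabilityMeasure_map (Lp.aestronglyMeasurable U).aemeasurable
  refine Measure.ext_of_charFun (funext fun θ => ?_)
  have h1 : Tendsto (fun k => charFun (P.map (u (ns k))) θ) atTop (𝓝 (charFun (P.map U) θ)) := by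
    simp only [charFun_map_coeFn_Lp]
    refine tendsto_integral_of_dominated_convergence (fun _ => 1) (fun k => ?_)
      (integrable_const _) (fun k => ae_of_all _ fun ω => ?_) ?_
    · exact ((by fun_prop : Measurable fun x : ℝ =>
        Complex.exp (θ * x * Complex.I)).comp_aemeasurable
        (Lp.aestronglyMeasurable (u (ns k))).aemeasurable).aestronglyMeasurable
    · rw [← Complex.ofReal_mul, Complex.norm_exp_ofReal_mul_I]
    · filter_upwards [hae] with ω hω
      exact ((by fun_prop : Continuous fun x : ℝ =>
        Complex.exp (θ * x * Complex.I)).tendsto _).comp hω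
  have h2 : Tendsto (fun k => charFun (P.map (u (ns k))) θ) atTop
      (𝓝 (charFun (gaussianReal 0 (‖U‖₊ ^ 2)) θ)) := by
    have e : ∀ k, charFun (P.map (u (ns k))) θ
        = Complex.exp (-((‖u (ns k)‖ : ℂ) ^ 2 * θ ^ 2 / 2)) := fun k => by
      rw [hV _ (hu _), charFun_gaussianReal]; simp
    have e' : charFun (gaussianReal 0 (‖U‖₊ ^ 2)) θ
        = Complex.exp (-((‖U‖ : ℂ) ^ 2 * θ ^ 2 / 2)) := by
      rw [charFun_gaussianReal]; simp
    simp only [e, e']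
    have hn : Tendsto (fun k => ‖u (ns k)‖) atTop (𝓝 ‖U‖) :=
      (hlim.comp hns.tendsto_atTop).norm
    exact ((by fun_prop : Continuous fun x : ℝ =>
      Complex.exp (-((x : ℂ) ^ 2 * θ ^ 2 / 2))).tendsto _).comp hn
  exact tendsto_nhds_unique h1 h2

theorem inner_Lp_two_eq_integral {U V : Lp ℝ 2 P} {f g : Ω → ℝ} (hf : f =ᵐ[P] U)
    (hg : g =ᵐ[P] V) : inner ℝ U V = ∫ ω, f ω * g ω ∂P := by
  rw [L2.inner_def]
  refine integral_congr_ae ?_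
  filter_upwards [hf, hg] with ω h1 h2
  rw [h1, h2]
  simp [mul_comm]

theorem IsGaussianSubspace.integral_eq_zero {V : Submodule ℝ (Lp ℝ 2 P)}
    (hV : IsGaussianSubspace P V) {U : Lp ℝ 2 P} (hU : U ∈ V) : ∫ ω, U ω ∂P = 0 := by
  have h : ∫ x, x ∂(P.map U) = ∫ ω, U ω ∂P :=
    integral_map (Lp.aestronglyMeasurable U).aemeasurable aestronglyMeasurable_id
  rw [← h, hV U hU, integral_id_gaussianReal]

theorem IsGaussianSubspace.covariance_eq {V : Submodule ℝ (Lp ℝ 2 P)}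
    (hV : IsGaussianSubspace P V) {U W : Lp ℝ 2 P} (hU : U ∈ V) (hW : W ∈ V) {f g : Ω → ℝ}
    (hf : f =ᵐ[P] U) (hg : g =ᵐ[P] W) : cov[f, g; P] = inner ℝ U W := by
  rw [covariance, inner_Lp_two_eq_integral hf hg, integral_congr_ae hf, integral_congr_ae hg,
    hV.integral_eq_zero hU, hV.integral_eq_zero hW]
  simp

/-- A linear functional of finitely many coordinates is again an element of `V`, so its law is
Gaussian, which characterises joint Gaussianity. -/
theorem IsGaussianSubspace.isGaussianProcess {V : Submodule ℝ (Lp ℝ 2 P)}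
    (hV : IsGaussianSubspace P V) {ι : Type*} {U : ι → Lp ℝ 2 P} (hU : ∀ i, U i ∈ V)
    {Y : ι → Ω → ℝ} (hY : ∀ i, Y i =ᵐ[P] U i) : IsGaussianProcess Y P := by
  classical
  refine IsGaussianProcess.congr (X := fun i => (U i : Ω → ℝ)) ⟨fun I => ⟨?_⟩⟩
    (fun i => (hY i).symm)
  refine isGaussian_of_map_eq_gaussianReal fun L => ⟨0, ‖∑ i : I, L (Pi.single i 1) • U i‖₊ ^ 2, ?_⟩
  have hm : AEMeasurable (fun ω => I.restrict fun i => U i ω) P :=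
    aemeasurable_pi_lambda _ fun i => (Lp.aestronglyMeasurable (U i)).aemeasurable
  rw [← hV (∑ i : I, L (Pi.single i 1) • U i)
    (Submodule.sum_mem _ fun i _ => Submodule.smul_mem _ _ (hU i)),
    AEMeasurable.map_map_of_aemeasurable L.continuous.measurable.aemeasurable hm]
  refine Measure.map_congr ?_
  have h1 := Lp.coeFn_fun_finsetSum Finset.univ (fun i : I => L (Pi.single i 1) • U i)
  have h2 : ∀ᵐ ω ∂P, ∀ i : I, (L (Pi.single i 1) • U i : Lp ℝ 2 P) ω
      = L (Pi.single i 1) * U i ω :=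
    ae_all_iff.2 fun i => by
      filter_upwards [Lp.coeFn_smul (L (Pi.single i 1)) (U i)] with ω hω
      simpa using hω
  filter_upwards [h1, h2] with ω h1 h2
  rw [h1]
  simp only [h2, Function.comp]
  conv_lhs => rw [← Finset.univ_sum_single (I.restrict fun i => U i ω), map_sum]
  refine Finset.sum_congr rfl fun i _ => ?_
  rw [← mul_one (I.restrict (fun i => (U i : Ω → ℝ) ω) i), ← smul_eq_mul, Pi.single_smul', map_smul]
  simp [mul_comm]

theorem isGaussianSubspace_span_of_isGaussianProcess [IsProbabilityMeasure P] {ι : Type*}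
    {Y : ι → Ω → ℝ} (hY : IsGaussianProcess Y P) (h0 : ∀ i, ∫ ω, Y i ω ∂P = 0) {U : ι → Lp ℝ 2 P}
    (hU : ∀ i, Y i =ᵐ[P] U i) : IsGaussianSubspace P (Submodule.span ℝ (Set.range U)) := by
  intro W hW
  obtain ⟨c, rfl⟩ := Finsupp.mem_span_range_iff_exists_finsupp.1 hW
  have hmem : ∀ i, MemLp (Y i) 2 P := fun i => (hY.hasGaussianLaw_eval i).memLp_two
  have hsum : (fun ω => ∑ i ∈ c.support, c i * Y i ω)
      =ᵐ[P] (c.sum fun i a => a • U i : Lp ℝ 2 P) := by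
    have h1 : ∀ᵐ ω ∂P, ∀ i ∈ c.support, (c i • U i : Lp ℝ 2 P) ω = c i * Y i ω :=
      (ae_ball_iff c.support.countable_toSet).2 fun i _ => by
        filter_upwards [Lp.coeFn_smul (c i) (U i), hU i] with ω hω hω'
        rw [hω, hω']
        rfl
    filter_upwards [h1, Lp.coeFn_fun_finsetSum c.support (fun i => c i • U i)] with ω h1 h2
    rw [Finsupp.sum, h2]
    exact Finset.sum_congr rfl fun i hi => (h1 i hi).symm
  set W : Lp ℝ 2 P := c.sum fun i a => a • U i with hWdef
  have hlaw : HasGaussianLaw W P :=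
    ((hY.smul (fun i => c i)).hasGaussianLaw_fun_sum (I := c.support)).congr hsum
  have hmean : ∫ ω, W ω ∂P = 0 := by
    rw [← integral_congr_ae hsum, integral_finsetSum]
    · simp [integral_const_mul, h0]
    · exact fun i _ => ((hmem i).integrable one_le_two).const_mul _
  rw [hlaw.map_eq_gaussianReal, hmean, variance_of_integral_eq_zero
    (Lp.aestronglyMeasurable W).aemeasurable hmean]
  congr 1
  have : ∫ ω, W ω ^ 2 ∂P = ‖W‖ ^ 2 := by
    rw [← real_inner_self_eq_norm_sq, inner_Lp_two_eq_integral (ae_eq_refl _) (ae_eq_refl _)]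
    simp only [sq]
  rw [this]
  ext
  rw [Real.coe_toNNReal _ (sq_nonneg _)]
  simp

end

/-- In a Gaussian subspace, conditional expectation is orthogonal projection. -/
theorem IsGaussianSubspace.condExp_eq {Ω : Type*} {m mΩ : MeasurableSpace Ω} {P : Measure Ω}
    [IsProbabilityMeasure P] {V : Submodule ℝ (Lp ℝ 2 P)}
    (hV : IsGaussianSubspace P V)
    {ι : Type*} {Y : ι → Ω → ℝ} (hYm : ∀ i, Measurable (Y i)) {U : ι → Lp ℝ 2 P}
    (hU : ∀ i, U i ∈ V) (hY : ∀ i, Y i =ᵐ[P] U i) {X : Lp ℝ 2 P} (hX : X ∈ V) {p : Lp ℝ 2 P}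
    (hpV : p ∈ V) (hp : p ∈ (Submodule.span ℝ (Set.range U)).topologicalClosure)
    (hXp : ∀ i, inner ℝ (U i) (X - p) = 0) {f : Ω → ℝ} (hf : f =ᵐ[P] X)
    (hm : m = ⨆ i, MeasurableSpace.comap (Y i) inferInstance) : P[f | m] =ᵐ[P] p := by
  have hle : m ≤ mΩ := by
    rw [hm]
    exact iSup_le fun i => (hYm i).comap_le
  have hmeas : AEStronglyMeasurable[m] p P := by
    -- The `m`-measurable classes form a closed subspace containing every `U i`, hence `p`.
    have hsub : Submodule.span ℝ (Set.range U) ≤ lpMeas ℝ ℝ m 2 P := by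
      rw [Submodule.span_le]
      rintro _ ⟨i, rfl⟩
      refine mem_lpMeas_iff_aestronglyMeasurable.2 ⟨Y i, ?_, (hY i).symm⟩
      refine Measurable.stronglyMeasurable ?_
      rw [hm]
      exact (comap_measurable (Y i)).mono (le_iSup (fun i =>
        MeasurableSpace.comap (Y i) inferInstance) i) le_rfl
    exact mem_lpMeas_iff_aestronglyMeasurable.1 (Submodule.topologicalClosure_minimal _ hsub
      (isClosed_aestronglyMeasurable hle) hp)
  have hD : X - p ∈ V := V.sub_mem hX hpV
  -- The residual is jointly Gaussian with `Y` and uncorrelated with it, hence independent of `m`;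
  -- its conditional expectation is its mean, zero.
  have hG : IsGaussianProcess
      (Sum.elim (fun _ : Unit => ((X - p : Lp ℝ 2 P) : Ω → ℝ)) Y) P :=
    hV.isGaussianProcess (U := Sum.elim (fun _ => X - p) U)
      (by rintro (_ | i); exacts [hD, hU i]) (by rintro (_ | i); exacts [ae_eq_refl _, hY i])
  have hindep := hG.indepFun_of_covariance_eq_zero
    (fun _ => (Lp.aestronglyMeasurable _).aemeasurable) (fun i => (hYm i).aemeasurable)
    (fun _ i => by
      rw [hV.covariance_eq hD (hU i) (ae_eq_refl _) (hY i), real_inner_comm, hXp i])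
  rw [IndepFun_iff_Indep] at hindep
  have hm1 : MeasurableSpace.comap ((X - p : Lp ℝ 2 P) : Ω → ℝ) inferInstance
      ≤ MeasurableSpace.comap (fun ω (_ : Unit) => (X - p : Lp ℝ 2 P) ω) inferInstance := by
    rw [← measurable_iff_comap_le]
    exact (measurable_pi_apply ()).comp
      (comap_measurable (fun ω (_ : Unit) => (X - p : Lp ℝ 2 P) ω))
  have hm2 : m ≤ MeasurableSpace.comap (fun ω i => Y i ω) inferInstance := by
    rw [hm]
    refine iSup_le fun i => ?_
    rw [← measurable_iff_comap_le]
    exact (measurable_pi_apply i).comp (comap_measurable (fun ω i => Y i ω))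
  have hindep' := indep_of_indep_of_le_right (indep_of_indep_of_le_left hindep hm1) hm2
  have hDc : P[((X - p : Lp ℝ 2 P) : Ω → ℝ) | m] =ᵐ[P] fun _ => 0 := by
    have h := condExp_indep_eq (f := ((X - p : Lp ℝ 2 P) : Ω → ℝ))
      (Measurable.comap_le (Lp.stronglyMeasurable _).measurable) hle
      (comap_measurable _).stronglyMeasurable hindep'
    rwa [hV.integral_eq_zero hD] at h
  have hpi : Integrable p P := (Lp.memLp p).integrable one_le_two
  have hDi : Integrable ((X - p : Lp ℝ 2 P) : Ω → ℝ) P := (Lp.memLp _).integrable one_le_two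
  have hsum : f =ᵐ[P] (p : Ω → ℝ) + ((X - p : Lp ℝ 2 P) : Ω → ℝ) := by
    filter_upwards [hf, Lp.coeFn_sub X p] with ω h1 h2
    rw [Pi.add_apply, h1, h2, Pi.sub_apply, add_sub_cancel]
  filter_upwards [condExp_congr_ae (m := m) hsum, condExp_add hpi hDi m, hDc,
    condExp_of_aestronglyMeasurable' hle hmeas hpi] with ω h1 h2 h3 h4
  rw [h1, h2, Pi.add_apply, h3, h4, add_zero]

/-! ### Concentration of sums of squares of independent Gaussians. -/

/-- In the logarithm `-y - log (1 - 2 y) / 2` the linear terms cancel. The Taylor remainder of `log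
(1 - 2 y)` is at most `8 y ^ 2`, and half of it is the exponent. -/
theorem exp_neg_div_sqrt_le {y : ℝ} (hy : |y| ≤ 1 / 4) :
    Real.exp (-y) / √(1 - 2 * y) ≤ Real.exp (4 * y ^ 2) := by
  obtain ⟨h1, h2⟩ := abs_le.1 hy
  have hpos : 0 < 1 - 2 * y := by linarith
  have h3 : |2 * y| ≤ 1 / 2 := by rw [abs_mul, abs_two]; linarith
  have h4 := Real.abs_log_sub_add_sum_range_le (x := 2 * y) (by linarith) 1
  have h5 : |2 * y| ^ (1 + 1) / (1 - |2 * y|) ≤ 8 * y ^ 2 := by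
    rw [div_le_iff₀ (by linarith), sq_abs]
    nlinarith [sq_nonneg y]
  have h6 := (abs_le.1 (h4.trans h5)).1
  norm_num at h6
  rw [Real.sqrt_eq_rpow, Real.rpow_def_of_pos hpos, ← Real.exp_sub]
  exact Real.exp_le_exp.2 (by linarith)

section

variable {Ω : Type*} {mΩ : MeasurableSpace Ω} {P : Measure Ω}

theorem integral_exp_mul_sq_sub_gaussianReal {v : ℝ≥0} {r : ℝ} (hr : 2 * r * v < 1) :
    ∫ x, Real.exp (r * (x ^ 2 - v)) ∂(gaussianReal 0 v)
      = Real.exp (-(r * v)) / √(1 - 2 * (r * v)) := by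
  by_cases hv : v = 0
  · simp [hv]
  have hv0 : (0 : ℝ) < v := by positivity
  rw [integral_gaussianReal_eq_integral_smul hv]
  have e : ∀ x : ℝ, gaussianPDFReal 0 v x • Real.exp (r * (x ^ 2 - v))
      = (√(2 * Real.pi * v))⁻¹ * Real.exp (-(r * v))
        * Real.exp (-((1 - 2 * (r * v)) / (2 * v)) * x ^ 2) := by
    intro x
    simp only [gaussianPDFReal_def, smul_eq_mul]
    rw [mul_assoc (√(2 * Real.pi * v))⁻¹, mul_assoc (√(2 * Real.pi * v))⁻¹, ← Real.exp_add,
      ← Real.exp_add]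
    congr 2
    field_simp
    ring
  have hb : 0 < 1 - 2 * (r * v) := by linarith
  have hpi := Real.pi_pos
  simp only [e]
  rw [integral_const_mul, integral_gaussian, div_div_eq_mul_div, Real.sqrt_div (by positivity),
    show Real.pi * (2 * v) = 2 * Real.pi * v by ring]
  have : √(2 * Real.pi * v) ≠ 0 := by positivity
  field_simp

theorem mgf_sq_sub_of_map_eq_gaussianReal {X : Ω → ℝ} {v : ℝ≥0} (hX : AEMeasurable X P)
    (hlaw : P.map X = gaussianReal 0 v) {r : ℝ} (hr : |r| * v ≤ 1 / 4) :
    0 < mgf (fun ω => X ω ^ 2 - v) P r ∧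
      mgf (fun ω => X ω ^ 2 - v) P r ≤ Real.exp (4 * r ^ 2 * v ^ 2) := by
  have hrv : |r * v| ≤ 1 / 4 := by rwa [abs_mul, abs_of_nonneg v.coe_nonneg]
  have h1 : mgf (fun ω => X ω ^ 2 - v) P r = Real.exp (-(r * v)) / √(1 - 2 * (r * v)) := by
    rw [← integral_exp_mul_sq_sub_gaussianReal (by linarith [(abs_le.1 hrv).2]), ← hlaw,
      integral_map hX (by fun_prop)]
    rfl
  rw [h1]
  refine ⟨div_pos (Real.exp_pos _) (Real.sqrt_pos.2 (by linarith [(abs_le.1 hrv).2])), ?_⟩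
  refine (exp_neg_div_sqrt_le hrv).trans (le_of_eq ?_)
  ring_nf

/-- Independence adds up the exponents, and `v i ^ 2 ≤ b * v i` bounds their sum by largest variance
times total variance. -/
theorem mgf_sum_sq_sub_of_iIndepFun {X : ℕ → Ω → ℝ} {v : ℕ → ℝ≥0}
    (hX : ∀ i, AEMeasurable (X i) P) (hlaw : ∀ i, P.map (X i) = gaussianReal 0 (v i))
    (hindep : iIndepFun X P) {n : ℕ} {r b T : ℝ} (hb : ∀ i < n, (v i : ℝ) ≤ b)
    (hT : ∑ i ∈ Finset.range n, (v i : ℝ) ≤ T) (hr : |r| * b ≤ 1 / 4) (hb0 : 0 ≤ b) :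
    0 < mgf (fun ω => ∑ i ∈ Finset.range n, (X i ω ^ 2 - v i)) P r ∧
      mgf (fun ω => ∑ i ∈ Finset.range n, (X i ω ^ 2 - v i)) P r
        ≤ Real.exp (4 * r ^ 2 * b * T) := by
  have h1 : ∀ i ∈ Finset.range n, 0 < mgf (fun ω => X i ω ^ 2 - v i) P r ∧
      mgf (fun ω => X i ω ^ 2 - v i) P r ≤ Real.exp (4 * r ^ 2 * v i ^ 2) := fun i hi =>
    mgf_sq_sub_of_map_eq_gaussianReal (hX i) (hlaw i)
      ((mul_le_mul_of_nonneg_left (hb i (Finset.mem_range.1 hi)) (abs_nonneg r)).trans hr)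
  have hindep' : iIndepFun (fun i ω => X i ω ^ 2 - (v i : ℝ)) P :=
    hindep.comp (fun i x => x ^ 2 - (v i : ℝ)) (fun i => by fun_prop)
  have h2 : mgf (fun ω => ∑ i ∈ Finset.range n, (X i ω ^ 2 - v i)) P r
      = ∏ i ∈ Finset.range n, mgf (fun ω => X i ω ^ 2 - (v i : ℝ)) P r := by
    rw [← hindep'.mgf_sum₀ (fun i => by have := hX i; fun_prop)]
    congr 1
    ext ω
    simp
  rw [h2]
  refine ⟨Finset.prod_pos fun i hi => (h1 i hi).1, ?_⟩
  refine (Finset.prod_le_prod (fun i hi => (h1 i hi).1.le) fun i hi => (h1 i hi).2).trans ?_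
  rw [← Real.exp_sum, ← Finset.mul_sum]
  refine Real.exp_le_exp.2 ?_
  rw [mul_assoc (4 * r ^ 2)]
  refine mul_le_mul_of_nonneg_left ?_ (by positivity)
  calc ∑ i ∈ Finset.range n, (v i : ℝ) ^ 2 ≤ ∑ i ∈ Finset.range n, b * v i :=
        Finset.sum_le_sum fun i hi => by
          rw [sq]
          exact mul_le_mul_of_nonneg_right (hb i (Finset.mem_range.1 hi)) (v i).coe_nonneg
    _ = b * ∑ i ∈ Finset.range n, (v i : ℝ) := by rw [Finset.mul_sum]
    _ ≤ b * T := mul_le_mul_of_nonneg_left hT hb0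

/-- One term of the exponential series gives `|S| ^ k ≤ (k! / r ^ k) exp (r |S|)`, and `exp (r |S|)
≤ exp (r S) + exp (-r S)`. -/
theorem lintegral_abs_pow_le_of_mgf_le {S : Ω → ℝ} {r C : ℝ} (hr : 0 < r)
    (h1 : 0 < mgf S P r) (h2 : 0 < mgf S P (-r)) (h1C : mgf S P r ≤ C) (h2C : mgf S P (-r) ≤ C)
    [IsProbabilityMeasure P] (k : ℕ) :
    ∫⁻ ω, ENNReal.ofReal (|S ω| ^ k) ∂P ≤ ENNReal.ofReal (2 * C * k.factorial / r ^ k) := by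
  have hi1 := mgf_pos_iff.1 h1
  have hi2 := mgf_pos_iff.1 h2
  have hb : ∀ ω, |S ω| ^ k
      ≤ k.factorial / r ^ k * (Real.exp (r * S ω) + Real.exp (-r * S ω)) := by
    intro ω
    have h3 := Real.pow_div_factorial_le_exp (x := r * |S ω|) (by positivity) k
    have h4 : Real.exp (r * |S ω|) ≤ Real.exp (r * S ω) + Real.exp (-r * S ω) := by
      rcases abs_cases (S ω) with ⟨h, _⟩ | ⟨h, _⟩ <;> rw [h]
      · linarith [Real.exp_pos (-r * S ω)]
      · rw [mul_neg, ← neg_mul]; linarith [Real.exp_pos (r * S ω)]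
    have h5 := h3.trans h4
    rw [div_le_iff₀ (by positivity), mul_pow] at h5
    rw [div_mul_eq_mul_div, le_div_iff₀ (by positivity)]
    linarith
  calc ∫⁻ ω, ENNReal.ofReal (|S ω| ^ k) ∂P
      ≤ ∫⁻ ω, ENNReal.ofReal
          (k.factorial / r ^ k * (Real.exp (r * S ω) + Real.exp (-r * S ω))) ∂P :=
        lintegral_mono fun ω => ENNReal.ofReal_le_ofReal (hb ω)
    _ = ENNReal.ofReal
          (∫ ω, k.factorial / r ^ k * (Real.exp (r * S ω) + Real.exp (-r * S ω)) ∂P) :=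
        (ofReal_integral_eq_lintegral_ofReal ((hi1.add hi2).const_mul _)
          (ae_of_all _ fun ω => by
            change 0 ≤ k.factorial / r ^ k * (Real.exp (r * S ω) + Real.exp (-r * S ω))
            positivity)).symm
    _ ≤ _ := by
        refine ENNReal.ofReal_le_ofReal ?_
        rw [integral_const_mul, integral_add hi1 hi2]
        change k.factorial / r ^ k * (mgf S P r + mgf S P (-r)) ≤ _
        calc k.factorial / r ^ k * (mgf S P r + mgf S P (-r)) ≤ k.factorial / r ^ k * (C + C) := by
              gcongr
          _ = _ := by ring

/-- A sequence of random variables whose moment generating functions at `± n ^ c` stay bounded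
converges to `0` in `L²` and almost surely. -/
theorem tendsto_zero_of_mgf_le [IsProbabilityMeasure P] {S : ℕ → Ω → ℝ}
    (hS : ∀ n, AEMeasurable (S n) P) {c C : ℝ} (hc : 0 < c)
    (h : ∀ᶠ n : ℕ in atTop, ∀ r : ℝ, |r| = (n : ℝ) ^ c → 0 < mgf (S n) P r ∧ mgf (S n) P r ≤ C) :
    Tendsto (fun n => eLpNorm (S n) 2 P) atTop (𝓝 0) ∧
      ∀ᵐ ω ∂P, Tendsto (fun n => S n ω) atTop (𝓝 0) := by
  have hbound : ∀ᶠ n : ℕ in atTop, ∀ k : ℕ, ∫⁻ ω, ENNReal.ofReal (|S n ω| ^ k) ∂P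
      ≤ ENNReal.ofReal (2 * C * k.factorial * ((n : ℝ) ^ (-(c * k)))) := by
    filter_upwards [h, eventually_gt_atTop 0] with n hn hn0 k
    have hn0' : (0 : ℝ) < n := Nat.cast_pos.2 hn0
    have hr : 0 < (n : ℝ) ^ c := by positivity
    obtain ⟨h1, h2⟩ := hn _ (abs_of_pos hr)
    obtain ⟨h3, h4⟩ := hn (-(n : ℝ) ^ c) (by rw [abs_neg, abs_of_pos hr])
    refine (lintegral_abs_pow_le_of_mgf_le hr h1 h3 h2 h4 k).trans (le_of_eq ?_)
    rw [Real.rpow_neg hn0'.le, Real.rpow_mul_natCast hn0'.le, div_eq_mul_inv]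
  constructor
  · have h2 : Tendsto (fun n : ℕ =>
        (ENNReal.ofReal (2 * C * (2 : ℕ).factorial * ((n : ℝ) ^ (-(c * (2 : ℕ)))))) ^ (1 / 2 : ℝ))
        atTop (𝓝 0) := by
      have h3 : Tendsto (fun n : ℕ => 2 * C * (2 : ℕ).factorial * ((n : ℝ) ^ (-(c * (2 : ℕ)))))
          atTop (𝓝 (2 * C * (2 : ℕ).factorial * 0)) :=
        ((tendsto_rpow_neg_atTop (by positivity)).comp tendsto_natCast_atTop_atTop).const_mul _
      have h4 := (ENNReal.continuous_rpow_const (y := 1 / 2)).tendsto _ |>.comp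
        (ENNReal.tendsto_ofReal h3)
      simpa using! h4
    refine tendsto_of_tendsto_of_tendsto_of_le_of_le' tendsto_const_nhds h2
      (Eventually.of_forall fun _ => zero_le) ?_
    filter_upwards [hbound] with n hn
    rw [eLpNorm_eq_lintegral_rpow_enorm_toReal two_ne_zero ENNReal.ofNat_ne_top]
    simp only [ENNReal.toReal_ofNat]
    gcongr
    refine le_trans (le_of_eq ?_) (hn 2)
    refine lintegral_congr fun ω => ?_
    rw [← ofReal_norm, ENNReal.ofReal_rpow_of_nonneg (norm_nonneg _) zero_le_two]
    norm_num
  · obtain ⟨N, hN⟩ := eventually_atTop.1 hbound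
    -- With `c k > 1` the `k`-th moments, of order `n ^ (-c k)`, are summable. Hence the series of
    -- `|S n| ^ k` is almost surely finite and its terms tend to `0`.
    obtain ⟨k, hk⟩ := exists_nat_gt (1 / c)
    have hk1 : 1 < c * k := by rwa [div_lt_iff₀' hc] at hk
    have hk0 : k ≠ 0 := by rintro rfl; norm_num at hk1
    have hsummable : Summable fun n : ℕ =>
        2 * C * k.factorial * (((n + N : ℕ) : ℝ) ^ (-(c * k))) :=
      ((summable_nat_add_iff N).2 (Real.summable_nat_rpow.2 (by linarith))).mul_left _
    have hfin : ∫⁻ ω, ∑' n : ℕ, ENNReal.ofReal (|S (n + N) ω| ^ k) ∂P ≠ ∞ := by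
      rw [lintegral_tsum fun n => by have := hS (n + N); fun_prop]
      refine ne_top_of_le_ne_top hsummable.tsum_ofReal_ne_top ?_
      exact ENNReal.tsum_le_tsum fun n => hN (n + N) (Nat.le_add_left _ _) k
    filter_upwards [ae_lt_top' (AEMeasurable.tsum fun n => by
      have := hS (n + N); fun_prop) hfin] with ω hω
    have h1 := ENNReal.tendsto_atTop_zero_of_tsum_ne_top hω.ne
    have h2 : Tendsto (fun n => |S (n + N) ω| ^ k) atTop (𝓝 0) := by
      have := (ENNReal.tendsto_toReal ENNReal.zero_ne_top).comp h1
      simpa [Function.comp_def, ENNReal.toReal_ofReal, pow_nonneg] using this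
    have h3 : Tendsto (fun n => |S (n + N) ω|) atTop (𝓝 0) := by
      have := h2.rpow_const (p := (k : ℝ)⁻¹) (Or.inr (by positivity))
      rw [Real.zero_rpow (by positivity)] at this
      simpa only [Real.pow_rpow_inv_natCast (abs_nonneg _) hk0] using this
    exact (tendsto_add_atTop_iff_nat N).1 ((tendsto_zero_iff_abs_tendsto_zero _).2 h3)

/-- Sums of squares of independent centered Gaussian variables concentrate when the individual
variances decay polynomially. -/
theorem tendsto_sum_sq_of_iIndepFun_gaussian [IsProbabilityMeasure P] {X : ℕ → ℕ → Ω → ℝ}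
    {v : ℕ → ℕ → ℝ≥0} (hX : ∀ n i, AEMeasurable (X n i) P)
    (hlaw : ∀ n i, P.map (X n i) = gaussianReal 0 (v n i)) (hindep : ∀ n, iIndepFun (X n) P)
    {d b T : ℝ} (hd : 0 < d) (hb0 : 0 ≤ b) (hb : ∀ n, ∀ i < n, (v n i : ℝ) ≤ b * (n : ℝ) ^ (-d))
    (hT : ∀ n, ∑ i ∈ Finset.range n, (v n i : ℝ) ≤ T) :
    Tendsto (fun n => eLpNorm (fun ω => ∑ i ∈ Finset.range n, (X n i ω ^ 2 - v n i)) 2 P)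
      atTop (𝓝 0) ∧
    ∀ᵐ ω ∂P, Tendsto (fun n => ∑ i ∈ Finset.range n, (X n i ω ^ 2 - v n i)) atTop (𝓝 0) := by
  -- At `|r| = n ^ (d/2)` the product of `r ^ 2` with the variance bound `b n ^ (-d)` stays equal to
  -- `b`, while that of `|r|` tends to `0` and so falls below `1/4`.
  refine tendsto_zero_of_mgf_le (c := d / 2) (C := Real.exp (4 * b * T))
    (fun n => Finset.aemeasurable_fun_sum _ fun i _ => by have := hX n i; fun_prop)
    (by positivity) ?_
  have hlim : Tendsto (fun n : ℕ => b * (n : ℝ) ^ (-(d / 2))) atTop (𝓝 (b * 0)) :=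
    ((tendsto_rpow_neg_atTop (by positivity)).comp tendsto_natCast_atTop_atTop).const_mul _
  rw [mul_zero] at hlim
  filter_upwards [hlim.eventually_le_const (show (0 : ℝ) < 1 / 4 by norm_num),
    eventually_gt_atTop 0] with n hn hn0 r hr
  have hn0' : (0 : ℝ) < n := Nat.cast_pos.2 hn0
  have h1 : |r| * (b * (n : ℝ) ^ (-d)) ≤ 1 / 4 := by
    rw [hr, mul_left_comm, ← Real.rpow_add hn0']
    refine le_trans (le_of_eq ?_) hn
    ring_nf
  have h2 := mgf_sum_sq_sub_of_iIndepFun (hX n) (hlaw n) (hindep n) (hb n) (hT n) h1 (by positivity)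
  refine ⟨h2.1, h2.2.trans (le_of_eq ?_)⟩
  have h3 : r ^ 2 * (n : ℝ) ^ (-d) = 1 := by
    rw [← sq_abs, hr, ← Real.rpow_mul_natCast hn0'.le, ← Real.rpow_add hn0']
    norm_num
  congr 1
  linear_combination (4 * b * T) * h3

end

/-! ### Constants of the field and auxiliary estimates. -/

/-- Each `Z_H` is thus a standard fractional Brownian motion. Off `H = 1/2` this is the reflection
formula for `Γ(2H + 1) Γ(-2H)` with `sin (2πH) = 2 sin (πH) cos (πH)`. -/
theorem fieldConst_self {H : ℝ} (hH : H ∈ Set.Ioo (0 : ℝ) 1) : fieldConst H H = 1 := by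
  unfold fieldConst
  split_ifs with h
  · obtain rfl : H = 1 / 2 := by linarith
    rw [dualConst, show (2 : ℝ) * (1 / 2) + 1 = 2 by norm_num,
      show (3 : ℝ) - 2 * (1 / 2) = 2 by norm_num, Real.Gamma_two, show Real.pi * (1 / 2) = Real.pi / 2
      by ring, Real.sin_pi_div_two]
    simp
  · have hsin : 0 < Real.sin (Real.pi * H) :=
      Real.sin_pos_of_pos_of_lt_pi (mul_pos Real.pi_pos hH.1)
        (by nlinarith [Real.pi_pos, hH.2])
    have hG : 0 < Real.Gamma (2 * H + 1) := Real.Gamma_pos_of_pos (by linarith [hH.1])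
    have hrefl := Real.Gamma_mul_Gamma_one_sub (2 * H + 1)
    rw [show 1 - (2 * H + 1) = -(H + H) by ring,
      show Real.pi * (2 * H + 1) = 2 * (Real.pi * H) + Real.pi by ring, Real.sin_add_pi,
      Real.sin_two_mul] at hrefl
    have hcos : Real.cos (Real.pi * H) ≠ 0 := by
      intro h0
      have h1 : Real.cos (Real.pi * H) = Real.cos (Real.pi / 2) := by rw [h0, Real.cos_pi_div_two]
      have h2 := Real.injOn_cos ⟨by have := Real.pi_pos; have := hH.1; positivity,
        by nlinarith [Real.pi_pos, hH.2]⟩ ⟨by positivity, by linarith [Real.pi_pos]⟩ h1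
      have h3 : H = 1 / 2 := by
        have := Real.pi_pos
        field_simp at h2
        linarith
      exact h (by linarith)
    have hsq := Real.mul_self_sqrt (mul_pos hG hsin).le
    rw [sub_self, zero_mul, Real.cos_zero, show (H + H) * (Real.pi / 2) = Real.pi * H by ring]
    calc -(2 / Real.pi) * √(Real.Gamma (2 * H + 1) * Real.sin (Real.pi * H))
          * √(Real.Gamma (2 * H + 1) * Real.sin (Real.pi * H)) * Real.Gamma (-(H + H)) * 1
          * Real.cos (Real.pi * H)
        = -(2 / Real.pi) * (√(Real.Gamma (2 * H + 1) * Real.sin (Real.pi * H))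
          * √(Real.Gamma (2 * H + 1) * Real.sin (Real.pi * H))) * Real.Gamma (-(H + H))
          * Real.cos (Real.pi * H) := by ring
      _ = -(2 / Real.pi) * (Real.Gamma (2 * H + 1) * Real.Gamma (-(H + H)))
          * Real.sin (Real.pi * H) * Real.cos (Real.pi * H) := by rw [hsq]; ring
      _ = 1 := by
        rw [hrefl]
        have := Real.pi_ne_zero
        field_simp

/-- Factor as a difference of squares of `d`-th powers and use subadditivity of `x ^ d`. With `d = 1
- H` this bounds the variance of all increments uniformly, including those near time `0`. -/
theorem rpow_two_mul_sub_le {a b t d : ℝ} (ha : 0 ≤ a) (hab : a ≤ b) (hbt : b ≤ t) (hd : 0 < d)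
    (hd1 : d ≤ 1) : b ^ (2 * d) - a ^ (2 * d) ≤ (b - a) ^ d * (2 * t ^ d) := by
  have hb : 0 ≤ b := ha.trans hab
  have h1 : b ^ d ≤ a ^ d + (b - a) ^ d := by
    have := Real.rpow_add_le_add_rpow ha (sub_nonneg.2 hab) hd.le hd1
    rwa [add_sub_cancel] at this
  have h2 : b ^ d ≤ t ^ d := Real.rpow_le_rpow hb hbt hd.le
  have h3 : a ^ d ≤ b ^ d := Real.rpow_le_rpow ha hab hd.le
  have h4 : 0 ≤ a ^ d := by positivity
  have h5 : 0 ≤ (b - a) ^ d := Real.rpow_nonneg (sub_nonneg.2 hab) _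
  rw [mul_comm 2 d, Real.rpow_mul hb, Real.rpow_mul ha, Real.rpow_two, Real.rpow_two]
  calc (b ^ d) ^ 2 - (a ^ d) ^ 2 = (b ^ d - a ^ d) * (b ^ d + a ^ d) := by ring
    _ ≤ (b - a) ^ d * (2 * t ^ d) := by
      apply mul_le_mul <;> linarith

theorem inner_eq_zero_of_mem_closure_span {E ι : Type*} [NormedAddCommGroup E]
    [InnerProductSpace ℝ E] {U : ι → E} {e p : E} (h : ∀ i, inner ℝ (U i) e = 0)
    (hp : p ∈ (Submodule.span ℝ (Set.range U)).topologicalClosure) : inner ℝ p e = 0 := by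
  have hsub : Submodule.span ℝ (Set.range U) ≤ (ℝ ∙ e)ᗮ := by
    rw [Submodule.span_le]
    rintro _ ⟨i, rfl⟩
    exact Submodule.mem_orthogonal_singleton_iff_inner_left.2 (h i)
  exact Submodule.mem_orthogonal_singleton_iff_inner_left.1
    (Submodule.topologicalClosure_minimal _ hsub (Submodule.isClosed_orthogonal _) hp)

/-! ### The field in `L²` and its projections. -/

namespace IsFractionalGaussianField

variable {Ω : Type*} [MeasurableSpace Ω] {P : Measure Ω}
  {Z : Set.Ioo (0 : ℝ) 1 → ℝ≥0 → Ω → ℝ}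

theorem memLp_two (hZ : IsFractionalGaussianField P Z) (H : Set.Ioo (0 : ℝ) 1) (t : ℝ≥0) :
    MemLp (Z H t) 2 P := (hZ.gaussian.hasGaussianLaw_eval (H, t)).memLp_two

/-- The random variable `Z_H(t)` as an element of `L²`. -/
noncomputable def vec (hZ : IsFractionalGaussianField P Z) (H : Set.Ioo (0 : ℝ) 1) (t : ℝ≥0) :
    Lp ℝ 2 P := (hZ.memLp_two H t).toLp

theorem coeFn_vec (hZ : IsFractionalGaussianField P Z) (H : Set.Ioo (0 : ℝ) 1) (t : ℝ≥0) :
    Z H t =ᵐ[P] hZ.vec H t := (hZ.memLp_two H t).coeFn_toLp.symm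

/-- The closed Gaussian space spanned by the field. -/
noncomputable def gaussianSpace (hZ : IsFractionalGaussianField P Z) : Submodule ℝ (Lp ℝ 2 P) :=
  (Submodule.span ℝ (Set.range fun p : Set.Ioo (0 : ℝ) 1 × ℝ≥0 =>
    hZ.vec p.1 p.2)).topologicalClosure

theorem isGaussianSubspace [IsProbabilityMeasure P] (hZ : IsFractionalGaussianField P Z) :
    IsGaussianSubspace P hZ.gaussianSpace :=
  (isGaussianSubspace_span_of_isGaussianProcess hZ.gaussian (fun p => hZ.centered p.1 p.2)
    fun p => hZ.coeFn_vec p.1 p.2).topologicalClosure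

theorem vec_mem (hZ : IsFractionalGaussianField P Z) (H : Set.Ioo (0 : ℝ) 1) (t : ℝ≥0) :
    hZ.vec H t ∈ hZ.gaussianSpace :=
  Submodule.le_topologicalClosure _ (Submodule.subset_span ⟨(H, t), rfl⟩)

theorem inner_vec_self_index (hZ : IsFractionalGaussianField P Z) (H : Set.Ioo (0 : ℝ) 1)
    (t s : ℝ≥0) : inner ℝ (hZ.vec H t) (hZ.vec H s)
      = ((t : ℝ) ^ (2 * (H : ℝ)) + (s : ℝ) ^ (2 * (H : ℝ)) - |(t : ℝ) - s| ^ (2 * (H : ℝ))) / 2 := by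
  rw [inner_Lp_two_eq_integral (hZ.coeFn_vec H t) (hZ.coeFn_vec H s), hZ.covariance,
    fieldConst_self H.2, abs_of_nonneg t.coe_nonneg, abs_of_nonneg s.coe_nonneg, two_mul]
  ring

/-- With exponents summing to `1`, `r + t - |r - t| = 2 r`. The absence of `t` on the right is the
source of the martingale property. -/
theorem inner_vec_dualIndex (hZ : IsFractionalGaussianField P Z) (H : Set.Ioo (0 : ℝ) 1)
    {r t : ℝ≥0} (hrt : r ≤ t) :
    inner ℝ (hZ.vec H r) (hZ.vec (dualIndex H) t) = dualConst H * r := by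
  have h1 : (H : ℝ) + dualIndex H = 1 := add_sub_cancel _ _
  have h2 : |(r : ℝ) - t| = t - r := by
    rw [abs_sub_comm, abs_of_nonneg (sub_nonneg.2 (NNReal.coe_le_coe.2 hrt))]
  rw [inner_Lp_two_eq_integral (hZ.coeFn_vec H r) (hZ.coeFn_vec _ t), hZ.covariance, fieldConst,
    if_pos h1, h1, Real.rpow_one, Real.rpow_one, Real.rpow_one, h2, abs_of_nonneg t.coe_nonneg,
    abs_of_nonneg r.coe_nonneg]
  ring

/-- The orthogonal projection of `Z_{1-H}(t)` onto the closed span of `Z_H(r)`, `r ≤ t`. -/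
theorem exists_projection (hZ : IsFractionalGaussianField P Z) (H : Set.Ioo (0 : ℝ) 1)
    (t : ℝ≥0) :
    ∃ p ∈ (Submodule.span ℝ (Set.range fun r : Set.Iic t => hZ.vec H r)).topologicalClosure,
      (∀ r : Set.Iic t, inner ℝ (hZ.vec H r) (hZ.vec (dualIndex H) t - p) = 0) ∧
      inner ℝ (hZ.vec (dualIndex H) t) p = martConst H * (t : ℝ) ^ (2 - 2 * (H : ℝ)) := by
  rcases eq_or_lt_of_le (zero_le (a := t)) with h0 | h0
  · refine ⟨0, Submodule.zero_mem _, fun r => ?_, ?_⟩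
    · have hr : (r : ℝ≥0) = 0 := le_antisymm (h0 ▸ r.2) zero_le
      rw [sub_zero, inner_vec_dualIndex hZ H r.2, hr]
      simp
    · rw [← h0, inner_zero_right, NNReal.coe_zero, Real.zero_rpow (by linarith [H.2.2]), mul_zero]
  · have ht : (0 : ℝ) < t := h0
    -- The interval `[0, t]` is rescaled to `[0, 1]`. Self-similarity gives `κ = t ^ (2H)` and the
    -- pairing slope is `b = a_H t`, so `b ^ 2 / κ` supplies the factor `t ^ (2 - 2H)`.
    obtain ⟨p, hp, horth, hin⟩ := exists_projection_of_fractional_gram (H := H)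
      (κ := (t : ℝ) ^ (2 * (H : ℝ))) (b := dualConst H * t) H.2 (by positivity)
      (z := fun u => hZ.vec H (t * u.toNNReal)) (X := hZ.vec (dualIndex H) t)
      (fun u hu s hs => by
        rw [inner_vec_self_index]
        simp only [NNReal.coe_mul, Real.coe_toNNReal u hu.1, Real.coe_toNNReal s hs.1]
        rw [Real.mul_rpow ht.le hu.1, Real.mul_rpow ht.le hs.1, ← mul_sub, abs_mul, abs_of_pos ht,
          Real.mul_rpow ht.le (abs_nonneg _), abs_sub_comm]
        ring)
      (fun u hu => by
        have hle : t * u.toNNReal ≤ t := mul_le_of_le_one_right zero_le (Real.toNNReal_le_one.2 hu.2)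
        rw [real_inner_comm, inner_vec_dualIndex hZ H hle, NNReal.coe_mul,
          Real.coe_toNNReal u hu.1, mul_assoc])
    refine ⟨p, ?_, fun r => ?_, ?_⟩
    · refine Submodule.topologicalClosure_mono (Submodule.span_mono ?_) hp
      rintro _ ⟨u, hu, rfl⟩
      exact ⟨⟨t * u.toNNReal, mul_le_of_le_one_right zero_le (Real.toNNReal_le_one.2 hu.2)⟩, rfl⟩
    · have h := horth ((r : ℝ≥0) / t : ℝ) ⟨by positivity, (div_le_one ht).2 r.2⟩
      have e : t * ((r : ℝ≥0) / t : ℝ).toNNReal = r := by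
        rw [← NNReal.coe_div, Real.toNNReal_coe, mul_div_cancel₀ _ h0.ne']
      simpa only [e] using h
    · rw [hin, martConst, Real.rpow_sub ht, Real.rpow_two]
      ring

end IsFractionalGaussianField

theorem IsGaussianSubspace.iIndepFun_of_inner_eq_zero {Ω ι : Type*} [MeasurableSpace Ω]
    {P : Measure Ω} {V : Submodule ℝ (Lp ℝ 2 P)} (hV : IsGaussianSubspace P V)
    {U : ι → Lp ℝ 2 P} (hU : ∀ i, U i ∈ V) (h : ∀ i j, i ≠ j → inner ℝ (U i) (U j) = 0) :
    iIndepFun (fun i => (U i : Ω → ℝ)) P := by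
  -- Each variable is treated as a block indexed by `Unit`, the form required by the independence
  -- criterion for families of processes.
  have hG : IsGaussianProcess (fun (q : (_ : ι) × Unit) ω => U q.1 ω) P :=
    hV.isGaussianProcess (U := fun q : (_ : ι) × Unit => U q.1) (fun q => hU q.1)
      fun q => ae_eq_refl _
  have h' := IsGaussianProcess.iIndepFun_of_covariance_eq_zero (S := fun _ : ι => Unit)
    (X := fun i _ => (U i : Ω → ℝ)) hG
    (fun i _ => (Lp.aestronglyMeasurable _).aemeasurable) (fun i j hij _ _ => by
      rw [hV.covariance_eq (hU i) (hU j) (ae_eq_refl _) (ae_eq_refl _), h i j hij])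
  exact h'.comp (fun _ f => f ()) fun _ => measurable_pi_apply ()

/-! ### Orthogonal and independent increments of the martingale. -/

namespace IsFractionalGaussianField

variable {Ω : Type*} [MeasurableSpace Ω] {P : Measure Ω}
  {Z : Set.Ioo (0 : ℝ) 1 → ℝ≥0 → Ω → ℝ}

/-- The martingale `M_H(t)` as an element of `L²`. -/
noncomputable def proj (hZ : IsFractionalGaussianField P Z) (H : Set.Ioo (0 : ℝ) 1) (t : ℝ≥0) :
    Lp ℝ 2 P := (hZ.exists_projection H t).choose

theorem proj_mem_closure_span (hZ : IsFractionalGaussianField P Z) (H : Set.Ioo (0 : ℝ) 1)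
    (t : ℝ≥0) : hZ.proj H t
      ∈ (Submodule.span ℝ (Set.range fun r : Set.Iic t => hZ.vec H r)).topologicalClosure :=
  (hZ.exists_projection H t).choose_spec.1

theorem inner_vec_sub_proj (hZ : IsFractionalGaussianField P Z) (H : Set.Ioo (0 : ℝ) 1)
    {r t : ℝ≥0} (hrt : r ≤ t) :
    inner ℝ (hZ.vec H r) (hZ.vec (dualIndex H) t - hZ.proj H t) = 0 :=
  (hZ.exists_projection H t).choose_spec.2.1 ⟨r, hrt⟩

theorem inner_vec_proj (hZ : IsFractionalGaussianField P Z) (H : Set.Ioo (0 : ℝ) 1) (t : ℝ≥0) :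
    inner ℝ (hZ.vec (dualIndex H) t) (hZ.proj H t)
      = martConst H * (t : ℝ) ^ (2 - 2 * (H : ℝ)) :=
  (hZ.exists_projection H t).choose_spec.2.2

theorem proj_mem (hZ : IsFractionalGaussianField P Z) (H : Set.Ioo (0 : ℝ) 1) (t : ℝ≥0) :
    hZ.proj H t ∈ hZ.gaussianSpace := by
  refine Submodule.topologicalClosure_mono (Submodule.span_mono ?_) (hZ.proj_mem_closure_span H t)
  rintro _ ⟨r, rfl⟩
  exact ⟨(H, r), rfl⟩

theorem condExp_eq_proj [IsProbabilityMeasure P] (hZ : IsFractionalGaussianField P Z)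
    (H : Set.Ioo (0 : ℝ) 1) (t : ℝ≥0) :
    condExp (fieldSigma Z H t) P (Z (dualIndex H) t) =ᵐ[P] hZ.proj H t :=
  hZ.isGaussianSubspace.condExp_eq (Y := fun r : Set.Iic t => Z H r)
    (U := fun r : Set.Iic t => hZ.vec H r) (fun r => hZ.measurable H r) (fun r => hZ.vec_mem H r)
    (fun r => hZ.coeFn_vec H r) (hZ.vec_mem _ t) (hZ.proj_mem H t) (hZ.proj_mem_closure_span H t)
    (fun r => hZ.inner_vec_sub_proj H r.2) (hZ.coeFn_vec _ t) iSup_subtype'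

/-- Both the residual at time `t` and the increment of `Z_{1-H}` from `s` to `t` are orthogonal to
the span up to time `s`, so `t` may be replaced by `s` in the pairing. -/
theorem inner_proj_proj (hZ : IsFractionalGaussianField P Z) (H : Set.Ioo (0 : ℝ) 1) {s t : ℝ≥0}
    (hst : s ≤ t) : inner ℝ (hZ.proj H s) (hZ.proj H t)
      = martConst H * (s : ℝ) ^ (2 - 2 * (H : ℝ)) := by
  have h1 : inner ℝ (hZ.proj H s) (hZ.vec (dualIndex H) t - hZ.proj H t) = 0 :=
    inner_eq_zero_of_mem_closure_span
      (fun r : Set.Iic s => hZ.inner_vec_sub_proj H (r.2.trans hst)) (hZ.proj_mem_closure_span H s)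
  have h2 : inner ℝ (hZ.proj H s) (hZ.vec (dualIndex H) t - hZ.vec (dualIndex H) s) = 0 :=
    inner_eq_zero_of_mem_closure_span (fun r : Set.Iic s => by
      rw [inner_sub_right, inner_vec_dualIndex hZ H (r.2.trans hst), inner_vec_dualIndex hZ H r.2,
        sub_self]) (hZ.proj_mem_closure_span H s)
  rw [← hZ.inner_vec_proj H s, real_inner_comm (hZ.proj H s) (hZ.vec (dualIndex H) s)]
  rw [inner_sub_right] at h1 h2
  linarith

theorem inner_proj_increment (hZ : IsFractionalGaussianField P Z) (H : Set.Ioo (0 : ℝ) 1)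
    {a b c d : ℝ≥0} (hab : a ≤ b) (hbc : b ≤ c) (hcd : c ≤ d) :
    inner ℝ (hZ.proj H b - hZ.proj H a) (hZ.proj H d - hZ.proj H c) = 0 := by
  rw [inner_sub_left, inner_sub_right, inner_sub_right, hZ.inner_proj_proj H hbc,
    hZ.inner_proj_proj H (hbc.trans hcd), hZ.inner_proj_proj H (hab.trans hbc),
    hZ.inner_proj_proj H (hab.trans (hbc.trans hcd))]
  ring

theorem norm_proj_increment_sq (hZ : IsFractionalGaussianField P Z) (H : Set.Ioo (0 : ℝ) 1)
    {a b : ℝ≥0} (hab : a ≤ b) : ‖hZ.proj H b - hZ.proj H a‖ ^ 2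
      = martConst H * (b : ℝ) ^ (2 - 2 * (H : ℝ)) - martConst H * (a : ℝ) ^ (2 - 2 * (H : ℝ)) := by
  rw [← real_inner_self_eq_norm_sq, inner_sub_left, inner_sub_right, inner_sub_right,
    hZ.inner_proj_proj H le_rfl, hZ.inner_proj_proj H hab,
    real_inner_comm (hZ.proj H a) (hZ.proj H b), hZ.inner_proj_proj H hab,
    hZ.inner_proj_proj H le_rfl]
  ring

theorem iIndepFun_proj_increment [IsProbabilityMeasure P] (hZ : IsFractionalGaussianField P Z)
    (H : Set.Ioo (0 : ℝ) 1) {τ : ℕ → ℝ≥0} (hτ : Monotone τ) :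
    iIndepFun (fun i => ((hZ.proj H (τ (i + 1)) - hZ.proj H (τ i) : Lp ℝ 2 P) : Ω → ℝ)) P := by
  refine hZ.isGaussianSubspace.iIndepFun_of_inner_eq_zero
    (U := fun i => hZ.proj H (τ (i + 1)) - hZ.proj H (τ i))
    (fun i => Submodule.sub_mem _ (hZ.proj_mem H _) (hZ.proj_mem H _)) fun i j hij => ?_
  rcases lt_or_gt_of_ne hij with h | h
  · exact hZ.inner_proj_increment H (hτ (Nat.le_succ i)) (hτ h) (hτ (Nat.le_succ j))
  · rw [real_inner_comm]
    exact hZ.inner_proj_increment H (hτ (Nat.le_succ j)) (hτ h) (hτ (Nat.le_succ i))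

end IsFractionalGaussianField

/-! ### Convergence of the quadratic variation. -/

theorem martConst_nonneg {H : ℝ} (hH : H ∈ Set.Ioo (0 : ℝ) 1) : 0 ≤ martConst H := by
  have h0 := hH.1
  have h1 : 0 < Real.Gamma (3 / 2 - H) := Real.Gamma_pos_of_pos (by linarith [hH.2])
  have h2 : 0 < Real.Gamma (H + 1 / 2) := Real.Gamma_pos_of_pos (by linarith)
  have h3 : 0 < Real.Gamma (3 - 2 * H) := Real.Gamma_pos_of_pos (by linarith [hH.2])
  unfold martConst
  positivity

theorem mainTheorem8 {Ω : Type*} [MeasurableSpace Ω] (P : Measure Ω) [IsProbabilityMeasure P]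
    (Z : Set.Ioo (0 : ℝ) 1 → ℝ≥0 → Ω → ℝ) (hZ : IsFractionalGaussianField P Z)
    (H : Set.Ioo (0 : ℝ) 1) (M : ℝ≥0 → Ω → ℝ) (hM : IsFieldMartingale P Z H M) (t : ℝ≥0) :
    Tendsto
      (fun n : ℕ => eLpNorm
        (fun ω => sumSqIncrements M t n ω - martConst H * (t : ℝ) ^ (2 - 2 * (H : ℝ))) 2 P)
      atTop (𝓝 0) ∧
    ∀ᵐ ω ∂P, Tendsto (fun n : ℕ => sumSqIncrements M t n ω) atTop
      (𝓝 (martConst H * (t : ℝ) ^ (2 - 2 * (H : ℝ)))) := by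
  have hc := martConst_nonneg H.2
  set d : ℝ := 1 - H with hd
  have hd0 : 0 < d := sub_pos.2 H.2.2
  have hd1 : d ≤ 1 := by linarith [H.2.1]
  have h2d : 2 - 2 * (H : ℝ) = 2 * d := by rw [hd]; ring
  set g : ℝ → ℝ := fun x => martConst H * x ^ (2 - 2 * (H : ℝ)) with hg
  set τ : ℕ → ℕ → ℝ≥0 := fun n i => (i : ℝ≥0) * t / n with hτ
  have hτm : ∀ n, Monotone (τ n) := fun n i j hij => by
    simp only [hτ]
    gcongr
  set W : ℕ → ℕ → Lp ℝ 2 P := fun n i => hZ.proj H (τ n (i + 1)) - hZ.proj H (τ n i) with hW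
  have hWmem : ∀ n i, W n i ∈ hZ.gaussianSpace := fun n i =>
    Submodule.sub_mem _ (hZ.proj_mem H _) (hZ.proj_mem H _)
  have hvar : ∀ n i, ((‖W n i‖₊ ^ 2 : ℝ≥0) : ℝ) = g (τ n (i + 1)) - g (τ n i) := fun n i => by
    rw [NNReal.coe_pow, coe_nnnorm]
    exact hZ.norm_proj_increment_sq H (hτm n (Nat.le_succ i))
  have hsum : ∀ n, ∑ i ∈ Finset.range n, ((‖W n i‖₊ ^ 2 : ℝ≥0) : ℝ) = g (τ n n) - g (τ n 0) :=
    fun n => by simp only [hvar]; exact Finset.sum_range_sub (fun i => g (τ n i)) n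
  have hg0 : ∀ n, g (τ n 0) = 0 := fun n => by
    have : 2 * d ≠ 0 := by positivity
    simp [hg, hτ, h2d, Real.zero_rpow this]
  have hτn : ∀ n, 0 < n → τ n n = t := fun n hn => by
    have : (n : ℝ≥0) ≠ 0 := by positivity
    simp only [hτ]
    field_simp
  have hgt : 0 ≤ g t := mul_nonneg hc (by positivity)
  have hM' : ∀ᵐ ω ∂P, ∀ n i, M (τ n (i + 1)) ω - M (τ n i) ω = W n i ω := by
    refine ae_all_iff.2 fun n => ae_all_iff.2 fun i => ?_
    filter_upwards [hM (τ n (i + 1)), hM (τ n i), hZ.condExp_eq_proj H (τ n (i + 1)),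
      hZ.condExp_eq_proj H (τ n i), Lp.coeFn_sub (hZ.proj H (τ n (i + 1))) (hZ.proj H (τ n i))]
      with ω h1 h2 h3 h4 h5
    rw [h1, h2, h3, h4, h5, Pi.sub_apply]
  -- The variances telescope to `g t`. The case `n = 0` is excluded: both sums are then empty, while
  -- `g t` need not vanish.
  have hdiff : ∀ᵐ ω ∂P, ∀ n : ℕ, 0 < n → sumSqIncrements M t n ω - g t
      = ∑ i ∈ Finset.range n, (W n i ω ^ 2 - (‖W n i‖₊ ^ 2 : ℝ≥0)) := by
    filter_upwards [hM'] with ω hω n hn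
    rw [Finset.sum_sub_distrib, hsum, hg0, sub_zero, hτn n hn]
    congr 1
    exact Finset.sum_congr rfl fun i _ => by rw [← hω n i]
  -- The constant `b` comes from `rpow_two_mul_sub_le` with step `t / n`, which bounds a variance by
  -- `c_M (t / n) ^ d * 2 t ^ d`.
  obtain ⟨hL2, hae⟩ := tendsto_sum_sq_of_iIndepFun_gaussian (P := P) (X := fun n i => W n i)
    (v := fun n i => ‖W n i‖₊ ^ 2) (d := d) (b := martConst H * (2 * t ^ d * t ^ d)) (T := g t)
    (fun n i => (Lp.aestronglyMeasurable _).aemeasurable)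
    (fun n i => hZ.isGaussianSubspace _ (hWmem n i))
    (fun n => hZ.iIndepFun_proj_increment H (hτm n)) hd0 (by positivity)
    (fun n i hi => by
      have hn : 0 < n := by omega
      have hn' : (0 : ℝ) < n := Nat.cast_pos.2 hn
      have hle : τ n (i + 1) ≤ t := hτn n hn ▸ hτm n hi
      have hinc : (τ n (i + 1) : ℝ) - τ n i = t / n := by
        simp only [hτ]
        push_cast
        ring
      have h := rpow_two_mul_sub_le (τ n i).coe_nonneg (NNReal.coe_le_coe.2 (hτm n (Nat.le_succ i)))
        (NNReal.coe_le_coe.2 hle) hd0 hd1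
      rw [Nat.succ_eq_add_one, hinc, Real.div_rpow t.coe_nonneg hn'.le] at h
      rw [hvar, hg, h2d, ← mul_sub, Real.rpow_neg hn'.le, mul_assoc]
      refine mul_le_mul_of_nonneg_left (h.trans (le_of_eq ?_)) hc
      ring)
    (fun n => by
      rw [hsum, hg0, sub_zero]
      -- For `n = 0` the endpoint `τ 0 0` is `0`, so the telescoped value is `0` rather than `g t`.
      rcases Nat.eq_zero_or_pos n with rfl | hn
      · rw [hg0]; exact hgt
      · rw [hτn n hn])
  constructor
  · refine hL2.congr' ?_
    filter_upwards [eventually_gt_atTop 0] with n hn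
    refine eLpNorm_congr_ae ?_
    filter_upwards [hdiff] with ω hω
    exact (hω n hn).symm
  · filter_upwards [hae, hdiff] with ω h1 h2
    have h3 : Tendsto (fun n => sumSqIncrements M t n ω - g t) atTop (𝓝 0) := by
      refine h1.congr' ?_
      filter_upwards [eventually_gt_atTop 0] with n hn
      exact (h2 n hn).symm
    have := h3.add_const (g t)
    simpa using this
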